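/- Let $N \ge 1$ be an integer, let $G = (\mathbb{Z}/N\mathbb{Z})^\times/\{\pm 1\}$, let $H \subseteq G$ be a subgroup, and let $X_H = X_1(N)/H$. Thus $X_H(\mathbb{C}) = \Gamma_H \backslash (\mathbb{H} \cup \mathbb{P}^1(\mathbb{Q}))$, where $\Gamma_H$ is the group of matrices in $\Gamma_0(N)$ whose lower right entry has class in $H$; the cusps are the images of the points of $\mathbb{P}^1(\mathbb{Q})$. For $a \in G/H$, the diamond operator $\langle a \rangle$ sends $\Gamma_H z$ to $\Gamma_H \gamma z$ for any $\gamma \in \Gamma_0(N)$ whose lower right entry has class $a$. For a prime $q \nmid N$, the Hecke operator $T_q$ is the correspondence $\Gamma_H z \mapsto \sum_{\delta} \Gamma_H \delta z$, where $\delta$ runs through representatives of the cosets in $\Gamma_H \backslash \Gamma_H \left(\begin{smallmatrix} 1 & 0 \\ 0 & q \end{smallmatrix}\right) \Gamma_H$. Let $h_1, h_2 \in \mathbb{Z}_{\ge 0}[G/H][x]$ be polynomials whose coefficients are linear combinations of elements of $G/H$, acting as diamond operators on $X_H$, with nonnegative integer coefficients. Assume that $h_1$ is monic and that $\deg h_1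 > \deg h_2$, where the zero polynomial has degree $-\infty$. Let $q \nmid N$ be a prime. Then $t_1 = h_1(T_q)$ and $t_2 = h_2(T_q)$ are effective correspondences on $X_H$ (finite sums of correspondences given by double cosets $\Gamma_H g \Gamma_H$ with $g \in \mathrm{GL}_2(\mathbb{Q})$, $\det g > 0$), so that $t = t_1 - t_2$ induces an endomorphism of the divisor group of $X_H$ over $\mathbb{C}$. If $D$ is a divisor on $X_H$ over $\mathbb{C}$ with $t(D) = 0$, then $D$ is supported on cusps. -/

import Mathlib

open Matrix Matrix.SpecialLinearGroup CongruenceSubgroup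
open scoped MatrixGroups UpperHalfPlane Polynomial

noncomputable section

namespace ModularHecke

/-- The group `G = (ℤ/Nℤ)ˣ / {±1}`. -/
def DiamondGroup (N : ℕ) : Type :=
  (ZMod N)ˣ ⧸ Subgroup.zpowers (-1 : (ZMod N)ˣ)

instance (N : ℕ) : CommGroup (DiamondGroup N) :=
  inferInstanceAs (CommGroup ((ZMod N)ˣ ⧸ Subgroup.zpowers (-1 : (ZMod N)ˣ)))

/-- The projection `(ℤ/Nℤ)ˣ → (ℤ/Nℤ)ˣ / {±1}`. -/
def DiamondGroup.proj (N : ℕ) : (ZMod N)ˣ →* DiamondGroup N :=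
  QuotientGroup.mk' (Subgroup.zpowers (-1 : (ZMod N)ˣ))

/-- The homomorphism `Γ₀(N) → G/H` sending a matrix to the class of its lower right entry. -/
def diamondClass (N : ℕ) (H : Subgroup (DiamondGroup N)) :
    Gamma0 N →* DiamondGroup N ⧸ H :=
  (QuotientGroup.mk' H).comp
    ((DiamondGroup.proj N).comp (Gamma0Map N).toHomUnits)

theorem exists_gamma0_lower_right (N : ℕ) [NeZero N] (d : (ZMod N)ˣ) :
    ∃ γ : Gamma0 N, Gamma0Map N γ = d := by
  have hcop : IsCoprime (N : ℤ) (((d : ZMod N).val : ℕ) : ℤ) :=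
    Nat.isCoprime_iff_coprime.mpr (ZMod.val_coe_unit_coprime d).symm
  obtain ⟨u, v, huv⟩ := hcop
  refine ⟨⟨⟨!![v, -u; (N : ℤ), (((d : ZMod N).val : ℕ) : ℤ)], ?_⟩, ?_⟩, ?_⟩
  · rw [Matrix.det_fin_two_of]
    linarith
  · change (((N : ℕ) : ℤ) : ZMod N) = 0
    simp
  · simp [Gamma0Map]

theorem diamondClass_surjective (N : ℕ) [NeZero N] (H : Subgroup (DiamondGroup N)) :
    Function.Surjective (diamondClass N H) := by
  intro a
  obtain ⟨b, rfl⟩ := QuotientGroup.mk'_surjective H a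
  obtain ⟨d, rfl⟩ : ∃ d, DiamondGroup.proj N d = b := QuotientGroup.mk'_surjective _ b
  obtain ⟨γ, hγ⟩ := exists_gamma0_lower_right N d
  refine ⟨γ, ?_⟩
  have : (Gamma0Map N).toHomUnits γ = d := Units.ext hγ
  simp [diamondClass, this]

/-- The group `Γ_H` with `Γ₁(N) ⊆ Γ_H ⊆ Γ₀(N)`: the matrices in `Γ₀(N)` whose lower right entry
has class in `H`. The quotient `X₁(N)/H` is the quotient of the extended upper half plane
by `Γ_H`. -/
def GammaH (N : ℕ) (H : Subgroup (DiamondGroup N)) : Subgroup SL(2, ℤ) :=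
  (diamondClass N H).ker.map (Gamma0 N).subtype

/-- `Γ_H` as a subgroup of `GL₂(ℚ)`. -/
def GammaHQ (N : ℕ) (H : Subgroup (DiamondGroup N)) : Subgroup (GL (Fin 2) ℚ) :=
  (GammaH N H).map (mapGL ℚ)

/-- The extended upper half plane `ℍ ∪ ℙ¹(ℚ)`. -/
def ExtendedUpperHalfPlane : Type := ℍ ⊕ OnePoint ℚ

/-- The action by fractional linear transformations, on both parts. -/
instance : MulAction (GL (Fin 2) ℚ) ExtendedUpperHalfPlane :=
  letI : MulAction (GL (Fin 2) ℚ) ℍ :=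
    MulAction.compHom ℍ (GeneralLinearGroup.map (n := Fin 2) (algebraMap ℚ ℝ))
  inferInstanceAs (MulAction (GL (Fin 2) ℚ) (ℍ ⊕ OnePoint ℚ))

/-- The set `X_H(ℂ) = Γ_H \ (ℍ ∪ ℙ¹(ℚ))` of complex points of the modular curve
`X_H = X₁(N)/H`. -/
def ModularCurve (N : ℕ) (H : Subgroup (DiamondGroup N)) : Type :=
  MulAction.orbitRel.Quotient (GammaHQ N H) ExtendedUpperHalfPlane

/-- The point of `X_H(ℂ)` represented by a point of the extended upper half plane. -/
def ModularCurve.mk (N : ℕ) (H : Subgroup (DiamondGroup N)) (z : ExtendedUpperHalfPlane) :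
    ModularCurve N H :=
  Quotient.mk (MulAction.orbitRel (GammaHQ N H) ExtendedUpperHalfPlane) z

theorem ModularCurve.mk_smul (N : ℕ) (H : Subgroup (DiamondGroup N)) {g : GL (Fin 2) ℚ}
    (hg : g ∈ GammaHQ N H) (z : ExtendedUpperHalfPlane) :
    ModularCurve.mk N H (g • z) = ModularCurve.mk N H z :=
  Quotient.sound (s := MulAction.orbitRel (GammaHQ N H) ExtendedUpperHalfPlane) ⟨⟨g, hg⟩, rfl⟩

/-- The cusps are the points represented by elements of `ℙ¹(ℚ)`. -/
def ModularCurve.IsCusp {N : ℕ} {H : Subgroup (DiamondGroup N)} (x : ModularCurve N H) : Prop :=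
  ∃ c : OnePoint ℚ, x = ModularCurve.mk N H (Sum.inr c)

/-- The divisor group of `X_H` over `ℂ`. -/
abbrev Divisor (N : ℕ) (H : Subgroup (DiamondGroup N)) : Type := ModularCurve N H →₀ ℤ

theorem conj_mem_GammaHQ (N : ℕ) (H : Subgroup (DiamondGroup N)) (γ : Gamma0 N)
    {g : GL (Fin 2) ℚ} (hg : g ∈ GammaHQ N H) :
    mapGL ℚ (γ : SL(2, ℤ)) * g * (mapGL ℚ (γ : SL(2, ℤ)))⁻¹ ∈ GammaHQ N H := by
  obtain ⟨_, ⟨δ, hδ, rfl⟩, rfl⟩ := hg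
  refine ⟨_, ⟨γ * δ * γ⁻¹, ?_, rfl⟩, ?_⟩
  · exact (diamondClass N H).normal_ker.conj_mem δ hδ γ
  · simp

/-- `Γ₀(N)` acts on `X_H(ℂ)`, because it normalizes `Γ_H`. -/
instance (N : ℕ) (H : Subgroup (DiamondGroup N)) :
    MulAction (Gamma0 N) (ModularCurve N H) where
  smul γ := Quotient.map (fun z => mapGL ℚ (γ : SL(2, ℤ)) • z) (by
    rintro _ z ⟨⟨g, hg⟩, rfl⟩
    refine ⟨⟨_, conj_mem_GammaHQ N H γ hg⟩, ?_⟩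
    simp [Subgroup.smul_def, mul_smul])
  one_smul x := by
    induction x using Quotient.inductionOn with
    | h z => exact congrArg (ModularCurve.mk N H) (by simp)
  mul_smul γ δ x := by
    induction x using Quotient.inductionOn with
    | h z => exact congrArg (ModularCurve.mk N H) (by simp [mul_smul])

theorem gamma0_smul_mk (N : ℕ) (H : Subgroup (DiamondGroup N)) (γ : Gamma0 N)
    (z : ExtendedUpperHalfPlane) :
    γ • ModularCurve.mk N H z = ModularCurve.mk N H (mapGL ℚ (γ : SL(2, ℤ)) • z) :=
  rfl

theorem ker_diamondClass_le (N : ℕ) (H : Subgroup (DiamondGroup N)) :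
    (diamondClass N H).ker ≤ (MulAction.toPermHom (Gamma0 N) (ModularCurve N H)).ker := by
  intro γ hγ
  rw [MonoidHom.mem_ker]
  ext x
  induction x using Quotient.inductionOn with
  | h z => exact ModularCurve.mk_smul N H ⟨γ, ⟨γ, hγ, rfl⟩, rfl⟩ z

/-- The diamond operators `⟨a⟩`, `a ∈ G/H`, on points: `⟨a⟩` sends the class of `z` to the class
of `γ z` for any `γ ∈ Γ₀(N)` whose lower right entry has class `a`. -/
def diamond (N : ℕ) [NeZero N] (H : Subgroup (DiamondGroup N)) :
    DiamondGroup N ⧸ H →* Equiv.Perm (ModularCurve N H) :=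
  (diamondClass N H).liftOfSurjective (diamondClass_surjective N H)
    ⟨MulAction.toPermHom (Gamma0 N) (ModularCurve N H), ker_diamondClass_le N H⟩

theorem diamond_mk (N : ℕ) [NeZero N] (H : Subgroup (DiamondGroup N)) (γ : Gamma0 N)
    (z : ExtendedUpperHalfPlane) :
    diamond N H (diamondClass N H γ) (ModularCurve.mk N H z) =
      ModularCurve.mk N H (mapGL ℚ (γ : SL(2, ℤ)) • z) := by
  have h : diamond N H (diamondClass N H γ) =
      MulAction.toPermHom (Gamma0 N) (ModularCurve N H) γ :=
    MonoidHom.liftOfRightInverse_comp_apply ..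
  rw [h]
  rfl

/-- The diamond operators on divisors. -/
def diamondEnd (N : ℕ) [NeZero N] (H : Subgroup (DiamondGroup N)) :
    DiamondGroup N ⧸ H →* Module.End ℤ (Divisor N H) where
  toFun a := Finsupp.lmapDomain ℤ ℤ (diamond N H a)
  map_one' := by
    rw [map_one]
    exact Finsupp.lmapDomain_id ℤ ℤ
  map_mul' a b := by
    rw [map_mul]
    exact Finsupp.lmapDomain_comp ℤ ℤ (diamond N H b) (diamond N H a)

/-- The set `Γ_H \ GL₂(ℚ)` of right cosets `Γ_H g`. -/
abbrev RightCoset (N : ℕ) (H : Subgroup (DiamondGroup N)) : Type :=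
  Quotient (QuotientGroup.rightRel (GammaHQ N H))

/-- The set `Γ_H \ Γ_H g Γ_H` of right cosets contained in the double coset of `g`. -/
def cosetsIn (N : ℕ) (H : Subgroup (DiamondGroup N)) (g : GL (Fin 2) ℚ) :
    Set (RightCoset N H) :=
  Quotient.mk (QuotientGroup.rightRel (GammaHQ N H)) ''
    DoubleCoset.doubleCoset g (GammaHQ N H : Set (GL (Fin 2) ℚ)) (GammaHQ N H)

theorem mem_cosetsIn (N : ℕ) (H : Subgroup (DiamondGroup N)) (g : GL (Fin 2) ℚ)
    (c : RightCoset N H) :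
    c ∈ cosetsIn N H g ↔ ∃ γ ∈ GammaH N H,
      c = Quotient.mk (QuotientGroup.rightRel (GammaHQ N H)) (g * mapGL ℚ γ) := by
  constructor
  · rintro ⟨δ, hδ, rfl⟩
    obtain ⟨x, hx, _, ⟨γ, hγ, rfl⟩, rfl⟩ := DoubleCoset.mem_doubleCoset.mp hδ
    refine ⟨γ, hγ, Quotient.sound ?_⟩
    refine QuotientGroup.rightRel_apply.mpr ?_
    have : g * mapGL ℚ γ * (x * g * mapGL ℚ γ)⁻¹ = x⁻¹ := by group
    rw [this]
    exact inv_mem hx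
  · rintro ⟨γ, hγ, rfl⟩
    refine ⟨_, DoubleCoset.mem_doubleCoset.mpr ⟨1, one_mem _, mapGL ℚ γ, ⟨γ, hγ, rfl⟩, rfl⟩, ?_⟩
    simp

theorem Gamma_le_GammaH (N : ℕ) (H : Subgroup (DiamondGroup N)) : Gamma N ≤ GammaH N H := by
  intro γ hγ
  rw [Gamma_mem] at hγ
  refine ⟨⟨γ, hγ.2.2.1⟩, ?_, rfl⟩
  have : (Gamma0Map N).toHomUnits ⟨γ, hγ.2.2.1⟩ = 1 := Units.ext hγ.2.2.2
  simp only [SetLike.mem_coe, MonoidHom.mem_ker, diamondClass, MonoidHom.comp_apply, this, map_one]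

theorem cosetsIn_finite (N : ℕ) [NeZero N] (H : Subgroup (DiamondGroup N))
    (g : GL (Fin 2) ℚ) : (cosetsIn N H g).Finite := by
  obtain ⟨M, hM, hconj⟩ := exists_Gamma_le_conj g N
  have : NeZero M := ⟨hM⟩
  let π : SL(2, ℤ) → SL(2, ZMod M) := Matrix.SpecialLinearGroup.map (Int.castRingHom (ZMod M))
  have key : ∀ γ δ : SL(2, ℤ), π γ = π δ →
      Quotient.mk (QuotientGroup.rightRel (GammaHQ N H)) (g * mapGL ℚ γ) =
        Quotient.mk (QuotientGroup.rightRel (GammaHQ N H)) (g * mapGL ℚ δ) := by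
    intro γ δ h
    refine Quotient.sound (QuotientGroup.rightRel_apply.mpr ?_)
    have h1 : δ * γ⁻¹ ∈ Gamma M := by
      change Matrix.SpecialLinearGroup.map (Int.castRingHom (ZMod M)) (δ * γ⁻¹) = 1
      rw [map_mul, map_inv, mul_inv_eq_one]
      exact h.symm
    have h2 := hconj _ h1
    have h3 : g * mapGL ℚ δ * (g * mapGL ℚ γ)⁻¹ = g * mapGL ℚ (δ * γ⁻¹) * g⁻¹ := by
      rw [map_mul, map_inv]
      group
    rw [h3]
    exact Subgroup.map_mono (Gamma_le_GammaH N H) h2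
  refine Set.Finite.subset (Set.finite_range fun s : SL(2, ZMod M) =>
    Quotient.mk (QuotientGroup.rightRel (GammaHQ N H))
      (g * mapGL ℚ (Function.invFun π s))) ?_
  intro c hc
  obtain ⟨γ, -, rfl⟩ := (mem_cosetsIn N H g c).mp hc
  exact ⟨π γ, key _ _ (Function.invFun_eq ⟨γ, rfl⟩)⟩

/-- The point `Γ_H δ z` for a right coset `c = Γ_H δ`. -/
def cosetPoint (N : ℕ) (H : Subgroup (DiamondGroup N)) (z : ExtendedUpperHalfPlane) :
    RightCoset N H → ModularCurve N H :=
  Quotient.lift (fun δ => ModularCurve.mk N H (δ • z)) (by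
    intro a b hab
    have h := QuotientGroup.rightRel_apply.mp hab
    have : b • z = (b * a⁻¹) • (a • z) := by simp [mul_smul]
    exact (by rw [this, ModularCurve.mk_smul N H h] :
      ModularCurve.mk N H (a • z) = ModularCurve.mk N H (b • z)))

/-- The divisor `∑ Γ_H δ z`, summed over the right cosets `Γ_H δ` contained in `Γ_H g Γ_H`. -/
def doubleCosetSum (N : ℕ) [NeZero N] (H : Subgroup (DiamondGroup N)) (g : GL (Fin 2) ℚ)
    (z : ExtendedUpperHalfPlane) : Divisor N H :=
  ∑ c ∈ (cosetsIn_finite N H g).toFinset, Finsupp.single (cosetPoint N H z c) 1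

theorem doubleCosetSum_smul (N : ℕ) [NeZero N] (H : Subgroup (DiamondGroup N))
    (g : GL (Fin 2) ℚ) {x : GL (Fin 2) ℚ} (hx : x ∈ GammaHQ N H) (z : ExtendedUpperHalfPlane) :
    doubleCosetSum N H g (x • z) = doubleCosetSum N H g z := by
  let r : GL (Fin 2) ℚ → RightCoset N H → RightCoset N H := fun y =>
    Quotient.map (· * y) (by
      intro a b hab
      have h := QuotientGroup.rightRel_apply.mp hab
      refine QuotientGroup.rightRel_apply.mpr ?_
      have : b * y * (a * y)⁻¹ = b * a⁻¹ := by group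
      rwa [this])
  have hr : ∀ y ∈ GammaHQ N H, ∀ c ∈ cosetsIn N H g, r y c ∈ cosetsIn N H g := by
    rintro _ ⟨y, hy, rfl⟩ c hc
    obtain ⟨γ, hγ, rfl⟩ := (mem_cosetsIn N H g c).mp hc
    refine (mem_cosetsIn N H g _).mpr ⟨γ * y, mul_mem hγ hy, ?_⟩
    change Quotient.mk _ (g * mapGL ℚ γ * mapGL ℚ y) = _
    rw [map_mul, mul_assoc]
  refine Finset.sum_bij' (fun c _ => r x c) (fun c _ => r x⁻¹ c) ?_ ?_ ?_ ?_ ?_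
  · intro c hc
    exact (Set.Finite.mem_toFinset _).mpr (hr x hx c ((Set.Finite.mem_toFinset _).mp hc))
  · intro c hc
    exact (Set.Finite.mem_toFinset _).mpr
      (hr x⁻¹ (inv_mem hx) c ((Set.Finite.mem_toFinset _).mp hc))
  · intro c _
    induction c using Quotient.inductionOn with
    | h a => exact congrArg (Quotient.mk _) (by group)
  · intro c _
    induction c using Quotient.inductionOn with
    | h a => exact congrArg (Quotient.mk _) (by group)
  · intro c _
    induction c using Quotient.inductionOn with
    | h a =>
      refine congrArg (fun p => Finsupp.single p (1 : ℤ)) ?_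
      exact congrArg (ModularCurve.mk N H) (by rw [mul_smul])

/-- The endomorphism of the divisor group given by the double coset `Γ_H g Γ_H`. For `det g > 0`
it is the action on divisors of the effective algebraic correspondence
`X_H ← X(Γ_H ∩ g⁻¹ Γ_H g) → X_H`, whose two maps are induced by `z ↦ z` and `z ↦ g z`. -/
def doubleCosetEnd (N : ℕ) [NeZero N] (H : Subgroup (DiamondGroup N)) (g : GL (Fin 2) ℚ) :
    Module.End ℤ (Divisor N H) :=
  Finsupp.linearCombination ℤ
    (Quotient.lift (doubleCosetSum N H g) (by
      rintro _ z ⟨⟨x, hx⟩, rfl⟩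
      exact doubleCosetSum_smul N H g hx z) : ModularCurve N H → Divisor N H)

theorem doubleCosetEnd_single (N : ℕ) [NeZero N] (H : Subgroup (DiamondGroup N))
    (g : GL (Fin 2) ℚ) (z : ExtendedUpperHalfPlane) :
    doubleCosetEnd N H g (Finsupp.single (ModularCurve.mk N H z) 1) =
      ∑ c ∈ (cosetsIn_finite N H g).toFinset, Finsupp.single (cosetPoint N H z c) 1 := by
  refine (Finsupp.linearCombination_single ℤ _ _).trans ?_
  rw [one_smul]
  rfl

/-- The matrix with rows `(1, 0)` and `(0, q)`. -/
def heckeMatrix (q : ℕ) [NeZero q] : GL (Fin 2) ℚ :=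
  GeneralLinearGroup.mkOfDetNeZero !![1, 0; 0, (q : ℚ)]
    (by simpa [Matrix.det_fin_two_of] using NeZero.ne q)

/-- The Hecke operator `T_q` on divisors of `X_H`, for a prime `q ∤ N`. -/
def heckeT (N : ℕ) [NeZero N] (H : Subgroup (DiamondGroup N)) (q : ℕ) [NeZero q] :
    Module.End ℤ (Divisor N H) :=
  doubleCosetEnd N H (heckeMatrix q)

/-- The endomorphism `h(T_q) = ∑ᵢ aᵢ T_qⁱ` of the divisor group for a polynomial `h = ∑ᵢ aᵢ xⁱ`
over `ℤ_{≥0}[G/H]`, where elements of `G/H` act as diamond operators. -/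
def heckePoly (N : ℕ) [NeZero N] (H : Subgroup (DiamondGroup N)) (q : ℕ) [NeZero q]
    (h : (MonoidAlgebra ℕ (DiamondGroup N ⧸ H))[X]) : Module.End ℤ (Divisor N H) :=
  h.eval₂ (MonoidAlgebra.lift ℕ (Module.End ℤ (Divisor N H)) (DiamondGroup N ⧸ H)
    (diamondEnd N H) : MonoidAlgebra ℕ (DiamondGroup N ⧸ H) →+* Module.End ℤ (Divisor N H))
    (heckeT N H q)

/-- `t` is the action on divisors of an effective (modular) correspondence on `X_H`: a finite sum
of correspondences given by double cosets `Γ_H g Γ_H` with `g ∈ GL₂(ℚ)` of positive determinant. -/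
def IsEffectiveCorrespondence {N : ℕ} [NeZero N] {H : Subgroup (DiamondGroup N)}
    (t : Module.End ℤ (Divisor N H)) : Prop :=
  ∃ s : Multiset (GL (Fin 2) ℚ), (∀ g ∈ s, 0 < g.det.val) ∧
    t = (s.map (doubleCosetEnd N H)).sum

end ModularHecke

end

/-!
Effectiveness and the support statement are independent of each other.

*Effectiveness.* An operator of the form `Γ_H z ↦ ∑ Γ_H δ z`, with `Γ_H δ` running through a finite
multiset of right cosets that is invariant under right translation by `Γ_H`, is a sum of double coset
operators, because such a multiset is a union of `Γ_H`-orbits (`exists_multiset_of_invariant`). These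
operators form a semiring (`invariantCosetSums`) that contains `T_q` and the diamond operators.

*Support.* Over `ℂ` the graph of `q`-isogenies of an elliptic curve is a tree, or a volcano of
infinite depth in the CM case, so one can go down in it forever, and each vertex reached by a downward
step has just one neighbour above it. This is made precise by a height on the image in `X_H` of
`{g z | g ∈ GL₂(ℚ), det g > 0}`, for a point `z` of the upper half plane. Choose a nonzero rational
binary quadratic form `f` with `f ∘ s = det s • f` for all `s` of positive determinant that fix `z`:
the form that vanishes at `z` if `z` is a CM point, any form otherwise (`exists_stabilizer_form`).
The height of `g z` is `‖f ∘ g⁻¹‖ |det g|`, for the `q`-adic Gauss norm. It is well defined on `X_H`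
and invariant under diamond operators, and in the CM case it measures the `q`-part of the conductor
of the endomorphism ring.

`T_q` multiplies the height at most by `q` (`pointHeight_heckeT_le`). The factor `q` is attained,
because a nonzero form modulo `q` has at most two zeros among the `q + 1` points of the projective
line (`exists_pointHeight_heckeT_eq`). A point reached by a step with factor `q` determines the point
where the step began, because modulo `q` its form is a multiple of the square of a linear form
(`eq_of_pointHeight_heckeT_eq`). Hence there is no cancellation in top height, and `T_q` multiplies
the largest height on the support of a divisor exactly by `q` (`topHeight_end_eq`). So the leading
term `T_q ^ n D` of `h₁(T_q) D` has a larger height than all other terms of `h₁(T_q) D - h₂(T_q) D`,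
unless `D` has no point of positive height. As `z` itself has positive height and is arbitrary, `D`
is supported on cusps.
-/

namespace ModularHecke

variable {N : ℕ} {H : Subgroup (DiamondGroup N)}

/-! ### Right translation of cosets and products of double cosets -/

/-- The right coset `Γ_H g`. -/
abbrev RightCoset.mk (N : ℕ) (H : Subgroup (DiamondGroup N)) (g : GL (Fin 2) ℚ) :
    RightCoset N H :=
  Quotient.mk (QuotientGroup.rightRel (GammaHQ N H)) g

theorem RightCoset.mk_eq_mk {g h : GL (Fin 2) ℚ} :
    RightCoset.mk N H g = RightCoset.mk N H h ↔ h * g⁻¹ ∈ GammaHQ N H := by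
  rw [RightCoset.mk, RightCoset.mk, Quotient.eq]
  exact QuotientGroup.rightRel_apply

theorem RightCoset.mk_out (c : RightCoset N H) : RightCoset.mk N H c.out = c :=
  Quotient.out_eq c

/-- Right translation `Γ_H g ↦ Γ_H g y` on right cosets. -/
def RightCoset.translate (y : GL (Fin 2) ℚ) : RightCoset N H → RightCoset N H :=
  Quotient.map (· * y) (by
    intro a b hab
    have h := QuotientGroup.rightRel_apply.mp hab
    refine QuotientGroup.rightRel_apply.mpr ?_
    have : b * y * (a * y)⁻¹ = b * a⁻¹ := by group
    rwa [this])

theorem RightCoset.translate_mk (y g : GL (Fin 2) ℚ) :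
    (RightCoset.mk N H g).translate y = RightCoset.mk N H (g * y) := rfl

theorem RightCoset.translate_translate (x y : GL (Fin 2) ℚ) (c : RightCoset N H) :
    (c.translate x).translate y = c.translate (x * y) := by
  induction c using Quotient.inductionOn with
  | h a => exact congrArg (RightCoset.mk N H) (mul_assoc a x y)

theorem RightCoset.translate_injective (y : GL (Fin 2) ℚ) :
    Function.Injective (RightCoset.translate (N := N) (H := H) y) := by
  refine Function.LeftInverse.injective (g := RightCoset.translate y⁻¹) fun c => ?_
  rw [RightCoset.translate_translate]
  induction c using Quotient.inductionOn with
  | h a => exact congrArg (RightCoset.mk N H) (by group)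

theorem cosetPoint_mk (z : ExtendedUpperHalfPlane) (g : GL (Fin 2) ℚ) :
    cosetPoint N H z (RightCoset.mk N H g) = ModularCurve.mk N H (g • z) := rfl

theorem cosetPoint_translate (z : ExtendedUpperHalfPlane) (y : GL (Fin 2) ℚ)
    (c : RightCoset N H) :
    cosetPoint N H z (c.translate y) = cosetPoint N H (y • z) c := by
  induction c using Quotient.inductionOn with
  | h a => exact congrArg (ModularCurve.mk N H) (mul_smul a y z)

theorem det_of_mem_GammaHQ {g : GL (Fin 2) ℚ} (hg : g ∈ GammaHQ N H) :
    g.det = 1 := by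
  obtain ⟨γ, -, rfl⟩ := hg
  ext
  simp

theorem RightCoset.det_eq {g h : GL (Fin 2) ℚ}
    (e : RightCoset.mk N H g = RightCoset.mk N H h) : g.det = h.det := by
  have := det_of_mem_GammaHQ (RightCoset.mk_eq_mk.mp e)
  rw [map_mul, map_inv, mul_inv_eq_one] at this
  exact this.symm

theorem Divisor.end_ext {s t : Module.End ℤ (Divisor N H)}
    (h : ∀ z, s (Finsupp.single (ModularCurve.mk N H z) 1) =
      t (Finsupp.single (ModularCurve.mk N H z) 1)) : s = t := by
  refine Finsupp.lhom_ext' fun x => LinearMap.ext_ring ?_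
  induction x using Quotient.inductionOn with
  | h z => exact h z

/-- `t` sends `Γ_H z` to `∑ Γ_H δ z`, where `Γ_H δ` runs through a multiset of right cosets of
positive determinant which is invariant under right translation by `Γ_H`. Allowing an arbitrary
invariant multiset in place of the cosets in a single double coset makes this notion visibly closed
under composition. -/
def IsInvariantCosetSum (t : Module.End ℤ (Divisor N H)) : Prop :=
  ∃ F : Multiset (RightCoset N H), (∀ x ∈ GammaHQ N H, F.map (RightCoset.translate x) = F) ∧
    (∀ g, RightCoset.mk N H g ∈ F → 0 < g.det.val) ∧
    ∀ z, t (Finsupp.single (ModularCurve.mk N H z) 1) =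
      (F.map fun c => Finsupp.single (cosetPoint N H z c) 1).sum

theorem IsInvariantCosetSum.zero : IsInvariantCosetSum (0 : Module.End ℤ (Divisor N H)) :=
  ⟨0, by simp, by simp, by simp⟩

theorem IsInvariantCosetSum.add {s t : Module.End ℤ (Divisor N H)}
    (hs : IsInvariantCosetSum s) (ht : IsInvariantCosetSum t) : IsInvariantCosetSum (s + t) := by
  obtain ⟨F, hF, hFd, hFs⟩ := hs
  obtain ⟨E, hE, hEd, hEt⟩ := ht
  refine ⟨F + E, fun x hx => by rw [Multiset.map_add, hF x hx, hE x hx], ?_, fun z => ?_⟩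
  · intro g hg
    exact (Multiset.mem_add.mp hg).elim (hFd g) (hEd g)
  · rw [LinearMap.add_apply, hFs, hEt, Multiset.map_add, Multiset.sum_add]

/-- The representative `δ` of a coset `Γ_H δ` may be changed in the cosets `Γ_H β δ`, because the
cosets `Γ_H β` form an invariant multiset. -/
theorem map_translate_eq_of_mk_eq {F : Multiset (RightCoset N H)}
    (hF : ∀ x ∈ GammaHQ N H, F.map (RightCoset.translate x) = F) {g h : GL (Fin 2) ℚ}
    (e : RightCoset.mk N H g = RightCoset.mk N H h) :
    F.map (RightCoset.translate g) = F.map (RightCoset.translate h) := by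
  conv_lhs => rw [← hF _ (RightCoset.mk_eq_mk.mp e)]
  conv_rhs => rw [← hF 1 (one_mem _)]
  have hx := RightCoset.mk_eq_mk.mp e
  calc (F.map (RightCoset.translate (h * g⁻¹))).map (RightCoset.translate g)
      = F.map (RightCoset.translate h) := by
        rw [Multiset.map_map]
        refine Multiset.map_congr rfl fun c _ => ?_
        rw [Function.comp_apply, RightCoset.translate_translate, inv_mul_cancel_right]
    _ = (F.map (RightCoset.translate 1)).map (RightCoset.translate h) := by rw [hF 1 (one_mem _)]

theorem IsInvariantCosetSum.mul {s t : Module.End ℤ (Divisor N H)}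
    (hs : IsInvariantCosetSum s) (ht : IsInvariantCosetSum t) : IsInvariantCosetSum (s * t) := by
  obtain ⟨F, hF, hFd, hFs⟩ := hs
  obtain ⟨E, hE, hEd, hEt⟩ := ht
  refine ⟨E.bind fun c => F.map (RightCoset.translate c.out), ?_, ?_, fun z => ?_⟩
  · intro x hx
    rw [Multiset.map_bind]
    conv_rhs => rw [← hE x hx, Multiset.bind_map]
    refine Multiset.bind_congr fun c _ => ?_
    have e : RightCoset.mk N H (c.out * x) = RightCoset.mk N H (c.translate x).out := by
      rw [RightCoset.mk_out, ← RightCoset.translate_mk, RightCoset.mk_out]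
    rw [← map_translate_eq_of_mk_eq hF e, Multiset.map_map]
    exact Multiset.map_congr rfl fun b _ => RightCoset.translate_translate _ _ b
  · intro g hg
    obtain ⟨c, hc, hg⟩ := Multiset.mem_bind.mp hg
    obtain ⟨b, hb, hg⟩ := Multiset.mem_map.mp hg
    rw [← RightCoset.mk_out b, RightCoset.translate_mk] at hg
    rw [← RightCoset.det_eq hg, map_mul, Units.val_mul]
    exact mul_pos (hFd _ (by rwa [RightCoset.mk_out])) (hEd _ (by rwa [RightCoset.mk_out]))
  · rw [Module.End.mul_apply, hEt, Multiset.map_bind, Multiset.sum_bind, map_multiset_sum,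
      Multiset.map_map]
    refine congrArg Multiset.sum (Multiset.map_congr rfl fun c _ => ?_)
    have : cosetPoint N H z c = ModularCurve.mk N H (c.out • z) := by
      conv_lhs => rw [← RightCoset.mk_out c]
      rfl
    rw [Function.comp_apply, this, hFs, Multiset.map_map]
    refine congrArg Multiset.sum (Multiset.map_congr rfl fun b _ => ?_)
    rw [Function.comp_apply, cosetPoint_translate]

theorem diamondEnd_isInvariantCosetSum [NeZero N] (a : DiamondGroup N ⧸ H) :
    IsInvariantCosetSum (diamondEnd N H a) := by
  obtain ⟨γ, rfl⟩ := diamondClass_surjective N H a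
  refine ⟨{RightCoset.mk N H (mapGL ℚ (γ : SL(2, ℤ)))}, fun x hx => ?_, fun g hg => ?_,
    fun z => ?_⟩
  · rw [Multiset.map_singleton, RightCoset.translate_mk, Multiset.singleton_inj, eq_comm,
      RightCoset.mk_eq_mk]
    exact conj_mem_GammaHQ N H γ hx
  · rw [RightCoset.det_eq (Multiset.mem_singleton.mp hg)]
    simp
  · rw [Multiset.map_singleton, Multiset.sum_singleton, cosetPoint_mk, ← diamond_mk]
    exact Finsupp.mapDomain_single

theorem translate_mem_cosetsIn {g x : GL (Fin 2) ℚ} (hx : x ∈ GammaHQ N H)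
    {c : RightCoset N H} (hc : c ∈ cosetsIn N H g) : c.translate x ∈ cosetsIn N H g := by
  obtain ⟨y, hy, rfl⟩ := hx
  obtain ⟨γ, hγ, rfl⟩ := (mem_cosetsIn N H g c).mp hc
  refine (mem_cosetsIn N H g _).mpr ⟨γ * y, mul_mem hγ hy, ?_⟩
  change Quotient.mk _ (g * mapGL ℚ γ * mapGL ℚ y) = _
  rw [map_mul, mul_assoc]

theorem map_translate_cosetsIn [NeZero N] (g : GL (Fin 2) ℚ) {x : GL (Fin 2) ℚ}
    (hx : x ∈ GammaHQ N H) :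
    (cosetsIn_finite N H g).toFinset.val.map (RightCoset.translate x) =
      (cosetsIn_finite N H g).toFinset.val := by
  refine Multiset.eq_of_le_of_card_le ?_ (by rw [Multiset.card_map])
  rw [Multiset.le_iff_subset ((Finset.nodup _).map (RightCoset.translate_injective x))]
  intro c hc
  obtain ⟨b, hb, rfl⟩ := Multiset.mem_map.mp hc
  rw [Finset.mem_val, Set.Finite.mem_toFinset] at hb ⊢
  exact translate_mem_cosetsIn hx hb

theorem heckeT_isInvariantCosetSum [NeZero N] (q : ℕ) [NeZero q] :
    IsInvariantCosetSum (heckeT N H q) := by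
  refine ⟨_, fun x hx => map_translate_cosetsIn (heckeMatrix q) hx, fun g hg => ?_, fun z =>
    doubleCosetEnd_single N H (heckeMatrix q) z⟩
  rw [Finset.mem_val, Set.Finite.mem_toFinset, mem_cosetsIn] at hg
  obtain ⟨γ, -, hg⟩ := hg
  have hq : (0 : ℚ) < q := Nat.cast_pos.mpr (NeZero.pos q)
  rw [RightCoset.det_eq hg, map_mul, Units.val_mul]
  simpa [heckeMatrix, GeneralLinearGroup.mkOfDetNeZero, Matrix.det_fin_two_of] using hq

/-- An invariant finite multiset of right cosets is a disjoint union of orbits of `Γ_H`, and the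
orbit of `Γ_H g` is the set of right cosets in `Γ_H g Γ_H`. -/
theorem exists_multiset_of_invariant [NeZero N] (F : Multiset (RightCoset N H))
    (hF : ∀ x ∈ GammaHQ N H, F.map (RightCoset.translate x) = F)
    (hd : ∀ g, RightCoset.mk N H g ∈ F → 0 < g.det.val) :
    ∃ s : Multiset (GL (Fin 2) ℚ), (∀ g ∈ s, 0 < g.det.val) ∧
      F = s.bind fun g => (cosetsIn_finite N H g).toFinset.val := by
  induction F using Multiset.strongInductionOn with
  | ih F ih =>
  obtain rfl | ⟨c, hc⟩ := F.empty_or_exists_mem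
  · exact ⟨0, by simp, by simp⟩
  obtain ⟨g, rfl⟩ : ∃ g, RightCoset.mk N H g = c := ⟨_, RightCoset.mk_out c⟩
  have hle : (cosetsIn_finite N H g).toFinset.val ≤ F := by
    rw [Multiset.le_iff_subset (Finset.nodup _)]
    intro b hb
    rw [Finset.mem_val, Set.Finite.mem_toFinset, mem_cosetsIn] at hb
    obtain ⟨γ, hγ, rfl⟩ := hb
    rw [← hF _ ⟨γ, hγ, rfl⟩]
    exact Multiset.mem_map_of_mem (RightCoset.translate (mapGL ℚ γ)) hc
  obtain ⟨E, rfl⟩ := Multiset.le_iff_exists_add.mp hle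
  have hg : RightCoset.mk N H g ∈ (cosetsIn_finite N H g).toFinset.val := by
    rw [Finset.mem_val, Set.Finite.mem_toFinset, mem_cosetsIn]
    exact ⟨1, one_mem _, by simp⟩
  have hlt : E < (cosetsIn_finite N H g).toFinset.val + E := by
    refine lt_of_le_of_ne (Multiset.le_add_left _ _) fun h => ?_
    rw [add_eq_right.mp h.symm] at hg
    exact Multiset.notMem_zero _ hg
  obtain ⟨s, hs, rfl⟩ := ih E hlt (fun x hx => by
    have h := hF x hx
    rw [Multiset.map_add, map_translate_cosetsIn g hx] at h
    exact add_left_cancel h) fun k hk => hd k (Multiset.mem_add.mpr (Or.inr hk))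
  refine ⟨g ::ₘ s, fun k hk => ?_, by rw [Multiset.cons_bind]⟩
  obtain rfl | hk := Multiset.mem_cons.mp hk
  · exact hd _ hc
  · exact hs k hk

theorem IsInvariantCosetSum.isEffectiveCorrespondence [NeZero N]
    {t : Module.End ℤ (Divisor N H)} (ht : IsInvariantCosetSum t) :
    IsEffectiveCorrespondence t := by
  obtain ⟨F, hF, hd, hFt⟩ := ht
  obtain ⟨s, hs, rfl⟩ := exists_multiset_of_invariant F hF hd
  refine ⟨s, hs, Divisor.end_ext fun z => ?_⟩
  rw [hFt, Multiset.map_bind, Multiset.sum_bind]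
  have : ∀ v : Divisor N H, (s.map (doubleCosetEnd N H)).sum v =
      (s.map fun g => doubleCosetEnd N H g v).sum := fun v => by
    simpa [Multiset.map_map] using
      map_multiset_sum (LinearMap.applyₗ (R := ℤ) v) (s.map (doubleCosetEnd N H))
  rw [this]
  exact congrArg Multiset.sum (Multiset.map_congr rfl fun g _ =>
    (doubleCosetEnd_single N H g z).symm)

/-- The operators given by invariant multisets of right cosets form a semiring. -/
def invariantCosetSums (N : ℕ) [NeZero N] (H : Subgroup (DiamondGroup N)) :
    Subsemiring (Module.End ℤ (Divisor N H)) where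
  carrier := {t | IsInvariantCosetSum t}
  zero_mem' := .zero
  one_mem' := map_one (diamondEnd N H) ▸ diamondEnd_isInvariantCosetSum 1
  add_mem' := .add
  mul_mem' := .mul

theorem heckePoly_isEffectiveCorrespondence [NeZero N] (q : ℕ) [NeZero q]
    (h : (MonoidAlgebra ℕ (DiamondGroup N ⧸ H))[X]) :
    IsEffectiveCorrespondence (heckePoly N H q h) := by
  refine IsInvariantCosetSum.isEffectiveCorrespondence ?_
  change _ ∈ invariantCosetSums N H
  rw [heckePoly, Polynomial.eval₂_eq_sum_range]
  refine sum_mem fun i _ => mul_mem ?_ (pow_mem (heckeT_isInvariantCosetSum q) i)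
  change MonoidAlgebra.lift _ _ _ _ _ ∈ _
  rw [MonoidAlgebra.lift_apply]
  exact sum_mem fun a _ => nsmul_mem (diamondEnd_isInvariantCosetSum a) _

/-! ### Operators on finitely supported functions that raise a height -/

/-- The largest value of the height `ht` on the support of `D`, and `0` if `D = 0`. -/
def topHeight {V : Type*} (ht : V → ℚ≥0) (D : V →₀ ℤ) : ℚ≥0 := D.support.sup ht

section TopHeight

variable {V : Type*} {ht : V → ℚ≥0}

theorem le_topHeight {D : V →₀ ℤ} {x : V} (hx : D x ≠ 0) : ht x ≤ topHeight ht D :=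
  Finset.le_sup (f := ht) (Finsupp.mem_support_iff.mpr hx)

theorem topHeight_le_iff {D : V →₀ ℤ} {m : ℚ≥0} :
    topHeight ht D ≤ m ↔ ∀ x, D x ≠ 0 → ht x ≤ m := by
  simp [topHeight]

theorem topHeight_zero : topHeight ht (0 : V →₀ ℤ) = 0 := by simp [topHeight]

theorem exists_ht_eq_topHeight {D : V →₀ ℤ} (h : 0 < topHeight ht D) :
    ∃ x, D x ≠ 0 ∧ ht x = topHeight ht D := by
  have hne : D.support.Nonempty := by
    rw [Finsupp.support_nonempty_iff]
    rintro rfl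
    exact h.ne' topHeight_zero
  obtain ⟨x, hx, he⟩ := Finset.exists_mem_eq_sup D.support hne ht
  exact ⟨x, Finsupp.mem_support_iff.mp hx, he.symm⟩

theorem topHeight_add_le (D E : V →₀ ℤ) :
    topHeight ht (D + E) ≤ max (topHeight ht D) (topHeight ht E) := by
  rw [topHeight_le_iff]
  intro x hx
  by_cases hD : D x = 0
  · have hE : E x ≠ 0 := by simpa [hD] using hx
    exact le_max_of_le_right (le_topHeight hE)
  · exact le_max_of_le_left (le_topHeight hD)

theorem topHeight_smul_le {R : Type*} [SMulZeroClass R ℤ] (n : R) (D : V →₀ ℤ) :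
    topHeight ht (n • D) ≤ topHeight ht D :=
  Finset.sup_mono Finsupp.support_smul

theorem topHeight_neg (D : V →₀ ℤ) : topHeight ht (-D) = topHeight ht D := by
  rw [topHeight, Finsupp.support_neg, topHeight]

theorem topHeight_sum_le {ι : Type*} {s : Finset ι} {D : ι → V →₀ ℤ} {m : ℚ≥0}
    (h : ∀ i ∈ s, topHeight ht (D i) ≤ m) : topHeight ht (∑ i ∈ s, D i) ≤ m :=
  Finset.sum_induction D (fun E => topHeight ht E ≤ m)
    (fun _ _ hD hE => (topHeight_add_le _ _).trans (max_le hD hE))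
    (topHeight_zero.trans_le zero_le) h

theorem topHeight_sum_lt {ι : Type*} {s : Finset ι} {D : ι → V →₀ ℤ} {m : ℚ≥0} (hm : 0 < m)
    (h : ∀ i ∈ s, topHeight ht (D i) < m) : topHeight ht (∑ i ∈ s, D i) < m :=
  Finset.sum_induction D (fun E => topHeight ht E < m)
    (fun _ _ hD hE => (topHeight_add_le _ _).trans_lt (max_lt hD hE))
    (topHeight_zero.trans_lt hm) h

theorem end_apply_eq_sum (T : Module.End ℤ (V →₀ ℤ)) (D : V →₀ ℤ) (y : V) :
    T D y = ∑ x ∈ D.support, D x * T (Finsupp.single x 1) y := by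
  conv_lhs => rw [← Finsupp.sum_single D, Finsupp.sum, map_sum, Finsupp.finsetSum_apply]
  refine Finset.sum_congr rfl fun x _ => ?_
  rw [← mul_one (D x), ← smul_eq_mul, ← Finsupp.smul_single, map_smul, Finsupp.smul_apply]
  simp

/-- An operator that raises the height of each point at most by the factor `c` raises the largest
height of a divisor at most by `c`. -/
theorem topHeight_end_le {T : Module.End ℤ (V →₀ ℤ)} {c : ℚ≥0}
    (hT : ∀ x y, T (Finsupp.single x 1) y ≠ 0 → ht y ≤ c * ht x) (D : V →₀ ℤ) :
    topHeight ht (T D) ≤ c * topHeight ht D := by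
  rw [topHeight_le_iff]
  intro y hy
  rw [end_apply_eq_sum] at hy
  obtain ⟨x, hx, hxy⟩ := Finset.exists_ne_zero_of_sum_ne_zero hy
  exact (hT x y (right_ne_zero_of_mul hxy)).trans
    (mul_le_mul_right (le_topHeight (Finsupp.mem_support_iff.mp hx)) c)

/-- If each point of positive height has a child of the largest possible height, and that child
has no other parent of the same height, then no cancellation occurs in top height. -/
theorem topHeight_end_eq {T : Module.End ℤ (V →₀ ℤ)} {c : ℚ≥0}
    (hT : ∀ x y, T (Finsupp.single x 1) y ≠ 0 → ht y ≤ c * ht x)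
    (hex : ∀ x, 0 < ht x → ∃ y, T (Finsupp.single x 1) y ≠ 0 ∧ ht y = c * ht x)
    (huniq : ∀ x x' y, 0 < ht x → ht x' = ht x → ht y = c * ht x →
      T (Finsupp.single x 1) y ≠ 0 → T (Finsupp.single x' 1) y ≠ 0 → x' = x)
    (hc : 0 < c) (D : V →₀ ℤ) :
    topHeight ht (T D) = c * topHeight ht D := by
  refine le_antisymm (topHeight_end_le hT D) ?_
  obtain h0 | hpos := (zero_le (a := topHeight ht D)).eq_or_lt
  · rw [← h0, mul_zero]
    exact zero_le
  obtain ⟨x, hx, hxt⟩ := exists_ht_eq_topHeight hpos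
  rw [← hxt] at hpos ⊢
  obtain ⟨y, hy, hyt⟩ := hex x hpos
  rw [← hyt]
  refine le_topHeight ?_
  rw [end_apply_eq_sum, Finset.sum_eq_single_of_mem x (Finsupp.mem_support_iff.mpr hx)]
  · exact mul_ne_zero hx hy
  · intro x' hx' hne
    by_contra hmul
    have hy' := right_ne_zero_of_mul hmul
    have hle : ht x' ≤ ht x := hxt ▸ le_topHeight (Finsupp.mem_support_iff.mp hx')
    have hge : ht x ≤ ht x' := le_of_mul_le_mul_left (hyt ▸ hT x' y hy') hc
    exact hne (huniq x x' y hpos (le_antisymm hle hge) hyt hy hy')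

end TopHeight

theorem heckePoly_apply [NeZero N] (q : ℕ) [NeZero q]
    (h : (MonoidAlgebra ℕ (DiamondGroup N ⧸ H))[X]) (D : Divisor N H) :
    heckePoly N H q h D = ∑ i ∈ h.support,
      MonoidAlgebra.lift ℕ (Module.End ℤ (Divisor N H)) (DiamondGroup N ⧸ H) (diamondEnd N H)
        (h.coeff i) ((heckeT N H q ^ i) D) := by
  rw [heckePoly, Polynomial.eval₂_eq_sum, Polynomial.sum, LinearMap.sum_apply]
  rfl

section HeckePoly

variable [NeZero N] {q : ℕ} [NeZero q] {ht : ModularCurve N H → ℚ≥0}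

theorem topHeight_lift_diamondEnd_le (hdia : ∀ a x, ht (diamond N H a x) ≤ ht x)
    (b : MonoidAlgebra ℕ (DiamondGroup N ⧸ H)) (D : Divisor N H) :
    topHeight ht (MonoidAlgebra.lift ℕ (Module.End ℤ (Divisor N H)) (DiamondGroup N ⧸ H)
      (diamondEnd N H) b D) ≤ topHeight ht D := by
  rw [MonoidAlgebra.lift_apply, Finsupp.sum, LinearMap.sum_apply]
  refine topHeight_sum_le fun a _ => ?_
  rw [LinearMap.smul_apply]
  refine (topHeight_smul_le _ _).trans ?_
  have h := topHeight_end_le (ht := ht) (T := diamondEnd N H a) (c := 1) (fun x y hy => ?_) D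
  · rwa [one_mul] at h
  have he : diamondEnd N H a (Finsupp.single x 1) = Finsupp.single (diamond N H a x) 1 :=
    Finsupp.mapDomain_single
  rw [he, Finsupp.single_apply_ne_zero] at hy
  rw [hy.1, one_mul]
  exact hdia a x

theorem topHeight_pow (hT : ∀ D, topHeight ht (heckeT N H q D) = q * topHeight ht D) (n : ℕ)
    (D : Divisor N H) : topHeight ht ((heckeT N H q ^ n) D) = q ^ n * topHeight ht D := by
  induction n with
  | zero => simp
  | succ n ih => rw [pow_succ', Module.End.mul_apply, hT, ih, pow_succ', mul_assoc]

theorem topHeight_heckePoly_lt (hq : 1 < q) (hdia : ∀ a x, ht (diamond N H a x) ≤ ht x)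
    (hT : ∀ D, topHeight ht (heckeT N H q D) = q * topHeight ht D)
    {h : (MonoidAlgebra ℕ (DiamondGroup N ⧸ H))[X]} {n : ℕ} (hn : h.degree < n)
    {D : Divisor N H} (hD : 0 < topHeight ht D) :
    topHeight ht (heckePoly N H q h D) < q ^ n * topHeight ht D := by
  have hq' : (1 : ℚ≥0) < q := by exact_mod_cast hq
  rw [heckePoly_apply]
  refine topHeight_sum_lt (mul_pos (pow_pos (zero_lt_one.trans hq') n) hD) fun i hi => ?_
  refine (topHeight_lift_diamondEnd_le hdia _ _).trans_lt ?_
  rw [topHeight_pow hT]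
  refine mul_lt_mul_of_pos_right (pow_lt_pow_right₀ hq' ?_) hD
  exact_mod_cast (Polynomial.le_degree_of_mem_supp i hi).trans_lt hn

/-- Since `T_q` multiplies the largest height by `q > 1`, in `h₁(T_q) D` the leading term `T_q ^ n D`
cannot be cancelled by the lower ones, nor by `h₂(T_q) D`. -/
theorem topHeight_eq_zero_of_heckePoly_eq (hq : 1 < q)
    (hdia : ∀ a x, ht (diamond N H a x) ≤ ht x)
    (hT : ∀ D, topHeight ht (heckeT N H q D) = q * topHeight ht D)
    {h₁ h₂ : (MonoidAlgebra ℕ (DiamondGroup N ⧸ H))[X]} (hmonic : h₁.Monic)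
    (hdeg : h₂.degree < h₁.degree) {D : Divisor N H}
    (h : heckePoly N H q h₁ D = heckePoly N H q h₂ D) : topHeight ht D = 0 := by
  by_contra hne
  have hpos := pos_iff_ne_zero.mpr hne
  have hd : h₁.degree = h₁.natDegree := Polynomial.degree_eq_natDegree hmonic.ne_zero
  have hlead : heckePoly N H q h₁ D =
      heckePoly N H q h₁.eraseLead D + (heckeT N H q ^ h₁.natDegree) D := by
    conv_lhs => rw [← Polynomial.eraseLead_add_C_mul_X_pow h₁, hmonic.leadingCoeff, map_one, one_mul]
    rw [heckePoly, Polynomial.eval₂_add, Polynomial.eval₂_X_pow]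
    rfl
  have he : (heckeT N H q ^ h₁.natDegree) D =
      heckePoly N H q h₂ D + -heckePoly N H q h₁.eraseLead D := by
    rw [← h, hlead]
    abel
  have hlt := (topHeight_add_le (ht := ht) (heckePoly N H q h₂ D)
    (-heckePoly N H q h₁.eraseLead D)).trans_lt (max_lt
      (topHeight_heckePoly_lt hq hdia hT (hd ▸ hdeg) hpos)
      ((topHeight_neg _).trans_lt (topHeight_heckePoly_lt hq hdia hT
        (hd ▸ Polynomial.degree_eraseLead_lt hmonic.ne_zero) hpos)))
  rw [← he, topHeight_pow hT] at hlt
  exact lt_irrefl _ hlt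

end HeckePoly

/-! ### Binary quadratic forms and their `q`-adic Gauss norm -/

/-- The binary quadratic form `a x² + b x y + c y²` over `ℚ`. -/
@[ext] structure BinForm where
  /-- The coefficient of `x²`. -/
  a : ℚ
  /-- The coefficient of `x y`. -/
  b : ℚ
  /-- The coefficient of `y²`. -/
  c : ℚ

namespace BinForm

/-- The form `v ↦ f (M v)`. -/
def comp (f : BinForm) (M : Matrix (Fin 2) (Fin 2) ℚ) : BinForm where
  a := f.a * M 0 0 ^ 2 + f.b * (M 0 0 * M 1 0) + f.c * M 1 0 ^ 2
  b := f.a * (2 * M 0 0 * M 0 1) + f.b * (M 0 0 * M 1 1 + M 0 1 * M 1 0) +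
    f.c * (2 * M 1 0 * M 1 1)
  c := f.a * M 0 1 ^ 2 + f.b * (M 0 1 * M 1 1) + f.c * M 1 1 ^ 2

theorem comp_mul (f : BinForm) (M P : Matrix (Fin 2) (Fin 2) ℚ) :
    f.comp (M * P) = (f.comp M).comp P := by
  ext <;> simp only [comp, Matrix.mul_apply, Fin.sum_univ_two] <;> ring

theorem comp_one (f : BinForm) : f.comp 1 = f := by
  ext <;> simp [comp]

/-- The multiple `r f`. -/
def scale (r : ℚ) (f : BinForm) : BinForm := ⟨r * f.a, r * f.b, r * f.c⟩

theorem scale_comp (r : ℚ) (f : BinForm) (M : Matrix (Fin 2) (Fin 2) ℚ) :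
    (f.scale r).comp M = (f.comp M).scale r := by
  ext <;> simp only [comp, scale] <;> ring

variable (q : ℕ)

/-- The `q`-adic Gauss norm of a form, the largest `q`-adic norm of a coefficient. -/
def gaussNorm (f : BinForm) : ℚ :=
  max (max (padicNorm q f.a) (padicNorm q f.b)) (padicNorm q f.c)

variable {q}

theorem norm_a_le (f : BinForm) : padicNorm q f.a ≤ f.gaussNorm q :=
  (le_max_left _ _).trans (le_max_left _ _)

theorem norm_b_le (f : BinForm) : padicNorm q f.b ≤ f.gaussNorm q :=
  (le_max_right _ _).trans (le_max_left _ _)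

theorem norm_c_le (f : BinForm) : padicNorm q f.c ≤ f.gaussNorm q :=
  le_max_right _ _

theorem gaussNorm_le_iff {f : BinForm} {m : ℚ} : f.gaussNorm q ≤ m ↔
    padicNorm q f.a ≤ m ∧ padicNorm q f.b ≤ m ∧ padicNorm q f.c ≤ m := by
  simp [gaussNorm, and_assoc]

theorem gaussNorm_nonneg (f : BinForm) : 0 ≤ f.gaussNorm q :=
  (padicNorm.nonneg _).trans (norm_a_le f)

variable [Fact q.Prime]

theorem gaussNorm_scale (r : ℚ) (f : BinForm) :
    (f.scale r).gaussNorm q = padicNorm q r * f.gaussNorm q := by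
  simp only [gaussNorm, scale, padicNorm.mul, mul_max_of_nonneg _ _ (padicNorm.nonneg r)]

theorem gaussNorm_pos {f : BinForm} (hf : f ≠ ⟨0, 0, 0⟩) : 0 < f.gaussNorm q := by
  refine (gaussNorm_nonneg f).lt_of_ne fun h => hf ?_
  have key : ∀ r : ℚ, padicNorm q r ≤ f.gaussNorm q → r = 0 := fun r hr =>
    padicNorm.zero_of_padicNorm_eq_zero (le_antisymm (h ▸ hr) (padicNorm.nonneg r))
  ext
  exacts [key _ (norm_a_le f), key _ (norm_b_le f), key _ (norm_c_le f)]

end BinForm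

section PadicNorm

variable {q : ℕ} [Fact q.Prime]

theorem padicNorm_add_le {x y m : ℚ} (hx : padicNorm q x ≤ m) (hy : padicNorm q y ≤ m) :
    padicNorm q (x + y) ≤ m :=
  padicNorm.nonarchimedean.trans (max_le hx hy)

theorem padicNorm_add_lt {x y m : ℚ} (hx : padicNorm q x < m) (hy : padicNorm q y < m) :
    padicNorm q (x + y) < m :=
  padicNorm.nonarchimedean.trans_lt (max_lt hx hy)

theorem padicNorm_mul_le {x y m : ℚ} (hx : padicNorm q x ≤ m) (hy : padicNorm q y ≤ 1) :
    padicNorm q (x * y) ≤ m := by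
  rw [padicNorm.mul]
  exact (mul_le_of_le_one_right (padicNorm.nonneg x) hy).trans hx

end PadicNorm

namespace BinForm

variable {q : ℕ} [Fact q.Prime]

theorem mapGL_val_apply (γ : SL(2, ℤ)) (i j : Fin 2) :
    (mapGL ℚ γ : GL (Fin 2) ℚ).val i j = (γ i j : ℚ) := rfl

theorem gaussNorm_comp_int_le (f : BinForm) (M : Matrix (Fin 2) (Fin 2) ℤ) :
    (f.comp (M.map (Int.cast : ℤ → ℚ))).gaussNorm q ≤ f.gaussNorm q := by
  have key : ∀ x y z : ℤ, padicNorm q (f.a * x + f.b * y + f.c * z) ≤ f.gaussNorm q :=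
    fun x y z => padicNorm_add_le (padicNorm_add_le
      (padicNorm_mul_le (norm_a_le f) (padicNorm.of_int x))
      (padicNorm_mul_le (norm_b_le f) (padicNorm.of_int y)))
      (padicNorm_mul_le (norm_c_le f) (padicNorm.of_int z))
  rw [gaussNorm_le_iff]
  refine ⟨?_, ?_, ?_⟩
  · simpa [comp, pow_two] using key (M 0 0 * M 0 0) (M 0 0 * M 1 0) (M 1 0 * M 1 0)
  · simpa [comp] using key (2 * M 0 0 * M 0 1) (M 0 0 * M 1 1 + M 0 1 * M 1 0)
      (2 * M 1 0 * M 1 1)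
  · simpa [comp, pow_two] using key (M 0 1 * M 0 1) (M 0 1 * M 1 1) (M 1 1 * M 1 1)

theorem gaussNorm_comp_mapGL (f : BinForm) (γ : SL(2, ℤ)) :
    (f.comp (mapGL ℚ γ : GL (Fin 2) ℚ)).gaussNorm q = f.gaussNorm q := by
  have key : ∀ (g : BinForm) (δ : SL(2, ℤ)),
      (g.comp (mapGL ℚ δ : GL (Fin 2) ℚ)).gaussNorm q ≤ g.gaussNorm q :=
    fun g δ => gaussNorm_comp_int_le g δ
  refine le_antisymm (key f γ) ?_
  have h := key (f.comp (mapGL ℚ γ : GL (Fin 2) ℚ)) γ⁻¹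
  rwa [← comp_mul, ← Units.val_mul, ← map_mul, mul_inv_cancel, map_one, Units.val_one,
    comp_one] at h

/-- A form attains its `q`-adic norm at the second column of some matrix in `Γ(N)`: the columns
`(0, 1)`, `(N, 1)` and `(N, 1 + N ^ 2 * t)` with `q ∣ 1 + N ^ 2 * t` are three distinct points of
the projective line over `𝔽_q`, and a nonzero form has at most two zeros there. -/
theorem exists_gamma_norm_c_eq (hqN : ¬ q ∣ N) {f : BinForm} (hf : f ≠ ⟨0, 0, 0⟩) :
    ∃ γ ∈ Gamma N, padicNorm q (f.comp (mapGL ℚ γ : GL (Fin 2) ℚ)).c = f.gaussNorm q := by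
  have hN : padicNorm q (N : ℚ) = 1 := (padicNorm.nat_eq_one_iff N).mpr hqN
  obtain ⟨t, ht⟩ : ∃ t : ℤ, (q : ℤ) ∣ 1 + N ^ 2 * t := by
    have hcop : IsCoprime ((N : ℤ) ^ 2) (q : ℤ) :=
      (Nat.isCoprime_iff_coprime.mpr
        ((Fact.out : q.Prime).coprime_iff_not_dvd.mpr hqN).symm).pow_left
    obtain ⟨u, v, huv⟩ := hcop
    exact ⟨-u, v, by linear_combination -huv⟩
  have htn : padicNorm q ((1 + N ^ 2 * t : ℤ) : ℚ) < 1 := padicNorm.int_lt_one_iff _ |>.mpr ht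
  by_contra! hcon
  have hlt : ∀ γ ∈ Gamma N,
      padicNorm q (f.comp (mapGL ℚ γ : GL (Fin 2) ℚ)).c < f.gaussNorm q := fun γ hγ =>
    lt_of_le_of_ne ((norm_c_le _).trans_eq (gaussNorm_comp_mapGL f γ)) (hcon γ hγ)
  have h1 := hlt 1 (one_mem _)
  rw [map_one, Units.val_one, comp_one] at h1
  have hcol : ∀ s : ℤ, padicNorm q (f.a * N ^ 2 + f.b * (N * (1 + N ^ 2 * s : ℤ)) +
      f.c * (1 + N ^ 2 * s : ℤ) ^ 2) < f.gaussNorm q := by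
    intro s
    obtain ⟨γ, hγ⟩ : ∃ γ : SL(2, ℤ),
        (γ : Matrix (Fin 2) (Fin 2) ℤ) = !![1, (N : ℤ); N * s, 1 + N ^ 2 * s] :=
      ⟨⟨_, by rw [Matrix.det_fin_two_of]; ring⟩, rfl⟩
    have h := hlt γ (by rw [Gamma_mem]; simp [hγ])
    simpa only [comp, mapGL_val_apply, hγ, of_apply, cons_val_zero, cons_val_one,
      Int.cast_natCast] using h
  have hcle : ∀ s : ℤ, padicNorm q (f.c * ((1 + N ^ 2 * s : ℤ) : ℚ) ^ 2) < f.gaussNorm q := by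
    intro s
    refine lt_of_le_of_lt (padicNorm_mul_le le_rfl ?_) h1
    rw [← Int.cast_pow]
    exact padicNorm.of_int _
  have hbt : padicNorm q (f.b * (N * (1 + N ^ 2 * t : ℤ))) < f.gaussNorm q := by
    rw [padicNorm.mul, padicNorm.mul, hN, one_mul]
    obtain h0 | hpos := (padicNorm.nonneg (p := q) f.b).eq_or_lt
    · rw [← h0, zero_mul]
      exact gaussNorm_pos hf
    · exact (mul_lt_of_lt_one_right hpos htn).trans_le (norm_b_le f)
  have ha' : padicNorm q (f.a * N ^ 2) < f.gaussNorm q := by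
    have h := padicNorm_add_lt (padicNorm_add_lt (hcol t) ((padicNorm.neg _).trans_lt hbt))
      ((padicNorm.neg _).trans_lt (hcle t))
    convert h using 2
    ring
  have hb' : padicNorm q (f.b * N) < f.gaussNorm q := by
    have h := padicNorm_add_lt (padicNorm_add_lt (hcol 0) ((padicNorm.neg _).trans_lt ha'))
      ((padicNorm.neg _).trans_lt (hcle 0))
    convert h using 2
    push_cast
    ring
  rw [pow_two, padicNorm.mul, padicNorm.mul, hN, mul_one, mul_one] at ha'
  rw [padicNorm.mul, hN, mul_one] at hb'
  exact lt_irrefl _ (max_lt (max_lt ha' hb') h1)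

end BinForm

/-! ### The height of a matrix relative to a form -/

section Height

/-- The height of `g ∈ GL₂(ℚ)` relative to the form `f`, that is `‖f ∘ g⁻¹‖ |det g|` for the `q`-adic
Gauss norm. -/
def height (q : ℕ) (f : BinForm) (g : GL (Fin 2) ℚ) : ℚ :=
  (f.comp (g⁻¹ : GL (Fin 2) ℚ)).gaussNorm q * padicNorm q g.det

theorem height_nonneg (q : ℕ) (f : BinForm) (g : GL (Fin 2) ℚ) : 0 ≤ height q f g :=
  mul_nonneg (BinForm.gaussNorm_nonneg _) (padicNorm.nonneg _)

variable {q : ℕ} [Fact q.Prime]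

theorem BinForm.comp_inv_mul (f : BinForm) (x g : GL (Fin 2) ℚ) :
    f.comp ((x * g)⁻¹ : GL (Fin 2) ℚ) =
      (f.comp (g⁻¹ : GL (Fin 2) ℚ)).comp (x⁻¹ : GL (Fin 2) ℚ) := by
  rw [_root_.mul_inv_rev, Units.val_mul, BinForm.comp_mul]

theorem BinForm.comp_ne_zero {f : BinForm} (hf : f ≠ ⟨0, 0, 0⟩) (g : GL (Fin 2) ℚ) :
    f.comp g ≠ ⟨0, 0, 0⟩ := by
  intro h
  have h' : (f.comp g).comp (g⁻¹ : GL (Fin 2) ℚ) = f := by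
    rw [← BinForm.comp_mul, ← Units.val_mul, mul_inv_cancel, Units.val_one, BinForm.comp_one]
  rw [h] at h'
  exact hf (h' ▸ by simp [BinForm.comp])

theorem height_pos {f : BinForm} (hf : f ≠ ⟨0, 0, 0⟩) (g : GL (Fin 2) ℚ) : 0 < height q f g :=
  mul_pos (BinForm.gaussNorm_pos (BinForm.comp_ne_zero hf _))
    ((padicNorm.nonneg _).lt_of_ne' (padicNorm.nonzero g.det.ne_zero))

theorem height_mapGL_mul (f : BinForm) (γ : SL(2, ℤ)) (g : GL (Fin 2) ℚ) :
    height q f (mapGL ℚ γ * g) = height q f g := by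
  rw [height, f.comp_inv_mul, ← map_inv, BinForm.gaussNorm_comp_mapGL, map_mul, height]
  simp

theorem height_mul_of_comp_eq {f : BinForm} {s : GL (Fin 2) ℚ}
    (hs : f.comp (s⁻¹ : GL (Fin 2) ℚ) = f.scale (s⁻¹).det.val) (g : GL (Fin 2) ℚ) :
    height q f (g * s) = height q f g := by
  have hd : padicNorm q (s⁻¹).det.val * padicNorm q s.det.val = 1 := by
    rw [← padicNorm.mul, ← Units.val_mul, ← map_mul, inv_mul_cancel, map_one, Units.val_one,
      padicNorm.one]
  rw [height, f.comp_inv_mul, hs, BinForm.scale_comp, BinForm.gaussNorm_scale, map_mul,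
    Units.val_mul, padicNorm.mul, height]
  linear_combination (f.comp (g⁻¹ : GL (Fin 2) ℚ)).gaussNorm q * padicNorm q g.det.val * hd

theorem val_heckeMatrix (q : ℕ) [NeZero q] :
    (heckeMatrix q : Matrix (Fin 2) (Fin 2) ℚ) = !![1, 0; 0, (q : ℚ)] := rfl

theorem det_heckeMatrix (q : ℕ) [NeZero q] : (heckeMatrix q).det.val = q := by
  rw [GeneralLinearGroup.val_det_apply, val_heckeMatrix, Matrix.det_fin_two_of]
  ring

theorem val_inv_heckeMatrix (q : ℕ) [NeZero q] :
    ((heckeMatrix q)⁻¹ : GL (Fin 2) ℚ).val = !![1, 0; 0, (q : ℚ)⁻¹] := by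
  have hq : (q : ℚ) ≠ 0 := Nat.cast_ne_zero.mpr (NeZero.ne q)
  refine Units.inv_eq_of_mul_eq_one_right ?_
  rw [val_heckeMatrix]
  ext i j
  fin_cases i <;> fin_cases j <;> simp [Matrix.mul_apply, hq]

theorem BinForm.comp_inv_heckeMatrix (f : BinForm) :
    f.comp ((heckeMatrix q)⁻¹ : GL (Fin 2) ℚ) =
      ⟨f.a, f.b * (q : ℚ)⁻¹, f.c * (q : ℚ)⁻¹ ^ 2⟩ := by
  rw [val_inv_heckeMatrix]
  ext <;> simp [BinForm.comp]

theorem padicNorm_inv_prime : padicNorm q (q : ℚ)⁻¹ = q := by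
  have h := padicNorm.div (p := q) 1 (q : ℚ)
  rwa [one_div, padicNorm.one, padicNorm.padicNorm_p_of_prime, one_div, inv_inv] at h

theorem one_lt_prime_cast : (1 : ℚ) < q := by
  exact_mod_cast (Fact.out : q.Prime).one_lt

theorem height_heckeMatrix_mul (f : BinForm) (g : GL (Fin 2) ℚ) :
    height q f (heckeMatrix q * g) * q =
      max (max (padicNorm q (f.comp (g⁻¹ : GL (Fin 2) ℚ)).a)
        (padicNorm q (f.comp (g⁻¹ : GL (Fin 2) ℚ)).b * q))
        (padicNorm q (f.comp (g⁻¹ : GL (Fin 2) ℚ)).c * q ^ 2) * padicNorm q g.det := by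
  have hq : (q : ℚ) ≠ 0 := (zero_lt_one.trans one_lt_prime_cast).ne'
  rw [height, f.comp_inv_mul, BinForm.comp_inv_heckeMatrix, map_mul, Units.val_mul,
    det_heckeMatrix, padicNorm.mul, padicNorm.padicNorm_p_of_prime, BinForm.gaussNorm]
  simp only [padicNorm.mul, padicNorm_inv_prime, pow_two]
  field_simp

theorem height_heckeMatrix_mul_le (f : BinForm) (g : GL (Fin 2) ℚ) :
    height q f (heckeMatrix q * g) ≤ q * height q f g := by
  have hq := one_lt_prime_cast (q := q)
  have hq0 := zero_lt_one.trans hq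
  refine le_of_mul_le_mul_right ?_ hq0
  rw [height_heckeMatrix_mul, height]
  have h0 := BinForm.gaussNorm_nonneg (q := q) (f.comp (g⁻¹ : GL (Fin 2) ℚ))
  calc _ ≤ (f.comp (g⁻¹ : GL (Fin 2) ℚ)).gaussNorm q * q ^ 2 * padicNorm q g.det := by
        refine mul_le_mul_of_nonneg_right (max_le (max_le ?_ ?_) ?_) (padicNorm.nonneg _)
        · exact (BinForm.norm_a_le _).trans (le_mul_of_one_le_right h0 (one_le_pow₀ hq.le))
        · exact mul_le_mul (BinForm.norm_b_le _) (le_self_pow₀ hq.le two_ne_zero) hq0.le h0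
        · exact mul_le_mul_of_nonneg_right (BinForm.norm_c_le _) (by positivity)
    _ = _ := by ring

/-- Multiplication by `diag(1, q)` raises the height by the full factor `q` exactly if the
coefficient of `y²` dominates. -/
theorem height_heckeMatrix_mul_eq_iff {f : BinForm} (hf : f ≠ ⟨0, 0, 0⟩) (g : GL (Fin 2) ℚ) :
    height q f (heckeMatrix q * g) = q * height q f g ↔
      padicNorm q (f.comp (g⁻¹ : GL (Fin 2) ℚ)).c =
        (f.comp (g⁻¹ : GL (Fin 2) ℚ)).gaussNorm q := by
  have hq := one_lt_prime_cast (q := q)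
  have hq0 := zero_lt_one.trans hq
  have hdet : 0 < padicNorm q g.det :=
    (padicNorm.nonneg _).lt_of_ne' (padicNorm.nonzero g.det.ne_zero)
  have hm := BinForm.gaussNorm_pos (q := q) (BinForm.comp_ne_zero hf g⁻¹)
  have ha := BinForm.norm_a_le (q := q) (f.comp (g⁻¹ : GL (Fin 2) ℚ))
  have hb := BinForm.norm_b_le (q := q) (f.comp (g⁻¹ : GL (Fin 2) ℚ))
  have hc := BinForm.norm_c_le (q := q) (f.comp (g⁻¹ : GL (Fin 2) ℚ))
  have hab : max (padicNorm q (f.comp (g⁻¹ : GL (Fin 2) ℚ)).a)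
      (padicNorm q (f.comp (g⁻¹ : GL (Fin 2) ℚ)).b * q) <
        (f.comp (g⁻¹ : GL (Fin 2) ℚ)).gaussNorm q * q ^ 2 := by
    refine max_lt (ha.trans_lt (lt_mul_of_one_lt_right hm (one_lt_pow₀ hq two_ne_zero))) ?_
    exact (mul_le_mul_of_nonneg_right hb hq0.le).trans_lt
      (mul_lt_mul_of_pos_left (lt_self_pow₀ hq one_lt_two) hm)
  rw [← mul_left_inj' hq0.ne', height_heckeMatrix_mul, height,
    show ∀ m d : ℚ, q * (m * d) * q = m * q ^ 2 * d by intros; ring, mul_left_inj' hdet.ne']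
  constructor
  · intro h
    obtain h' | h' := max_choice (max (padicNorm q (f.comp (g⁻¹ : GL (Fin 2) ℚ)).a)
      (padicNorm q (f.comp (g⁻¹ : GL (Fin 2) ℚ)).b * q))
      (padicNorm q (f.comp (g⁻¹ : GL (Fin 2) ℚ)).c * q ^ 2)
    · exact absurd (h'.symm.trans h) hab.ne
    · exact mul_right_cancel₀ (pow_ne_zero 2 hq0.ne') (h'.symm.trans h)
  · intro h
    rw [h]
    exact max_eq_right hab.le

theorem exists_gamma_height_eq (hqN : ¬ q ∣ N) {f : BinForm} (hf : f ≠ ⟨0, 0, 0⟩)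
    (g : GL (Fin 2) ℚ) :
    ∃ γ ∈ Gamma N, height q f (heckeMatrix q * mapGL ℚ γ * g) = q * height q f g := by
  obtain ⟨γ, hγ, h⟩ := BinForm.exists_gamma_norm_c_eq hqN (BinForm.comp_ne_zero hf g⁻¹)
  refine ⟨γ⁻¹, inv_mem hγ, ?_⟩
  rw [mul_assoc, ← height_mapGL_mul f γ⁻¹ g, height_heckeMatrix_mul_eq_iff hf, f.comp_inv_mul,
    map_inv, inv_inv, h, BinForm.gaussNorm_comp_mapGL]

/-- If two steps of full height gain, from `g` and from `h`, end at matrices that differ by `σ`,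
then `q` divides the lower left entry of `σ`: modulo `q` the form attached to `diag(1, q) h` is
proportional to `y²`, so that only one direction leads back to a matrix of smaller height. -/
theorem dvd_of_height_eq {f : BinForm} (hf : f ≠ ⟨0, 0, 0⟩) {g h : GL (Fin 2) ℚ} {σ : SL(2, ℤ)}
    (e : heckeMatrix q * g = mapGL ℚ σ * (heckeMatrix q * h))
    (hg : height q f (heckeMatrix q * g) = q * height q f g)
    (hh : height q f (heckeMatrix q * h) = q * height q f h) : (q : ℤ) ∣ σ 1 0 := by
  have hq := one_lt_prime_cast (q := q)
  have hq0 := zero_lt_one.trans hq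
  have dom : ∀ k : GL (Fin 2) ℚ, height q f (heckeMatrix q * k) = q * height q f k →
      padicNorm q (f.comp ((heckeMatrix q * k)⁻¹ : GL (Fin 2) ℚ)).a * q ≤
          padicNorm q (f.comp ((heckeMatrix q * k)⁻¹ : GL (Fin 2) ℚ)).c ∧
        padicNorm q (f.comp ((heckeMatrix q * k)⁻¹ : GL (Fin 2) ℚ)).b * q ≤
          padicNorm q (f.comp ((heckeMatrix q * k)⁻¹ : GL (Fin 2) ℚ)).c := by
    intro k hk
    have hk := (height_heckeMatrix_mul_eq_iff hf k).mp hk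
    have ha := hk ▸ BinForm.norm_a_le (q := q) (f.comp (k⁻¹ : GL (Fin 2) ℚ))
    have hb := hk ▸ BinForm.norm_b_le (q := q) (f.comp (k⁻¹ : GL (Fin 2) ℚ))
    rw [f.comp_inv_mul, BinForm.comp_inv_heckeMatrix]
    simp only [padicNorm.mul, padicNorm_inv_prime, pow_two]
    refine ⟨?_, ?_⟩
    · exact mul_le_mul ha (le_mul_of_one_le_left hq0.le hq.le) hq0.le (padicNorm.nonneg _)
    · rw [mul_assoc]
      exact mul_le_mul_of_nonneg_right hb (mul_pos hq0 hq0).le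
  obtain ⟨hga, -⟩ := dom g hg
  obtain ⟨hha, hhb⟩ := dom h hh
  have hF := BinForm.gaussNorm_pos (q := q)
    (BinForm.comp_ne_zero hf (heckeMatrix q * h)⁻¹)
  rw [e, f.comp_inv_mul (mapGL ℚ σ)] at hga
  set F := f.comp ((heckeMatrix q * h)⁻¹ : GL (Fin 2) ℚ)
  have hle : ∀ r : ℚ, padicNorm q r * q ≤ padicNorm q F.c → padicNorm q r ≤ padicNorm q F.c :=
    fun r hr => (le_mul_of_one_le_right (padicNorm.nonneg r) hq.le).trans hr
  have hFc : F.gaussNorm q = padicNorm q F.c :=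
    le_antisymm (BinForm.gaussNorm_le_iff.mpr ⟨hle _ hha, hle _ hhb, le_rfl⟩)
      (BinForm.norm_c_le F)
  have hcpos : 0 < padicNorm q F.c := hFc ▸ hF
  have hσc : padicNorm q (F.comp ((mapGL ℚ σ)⁻¹ : GL (Fin 2) ℚ)).c ≤ padicNorm q F.c := by
    refine (BinForm.norm_c_le _).trans_eq ?_
    rw [← map_inv, BinForm.gaussNorm_comp_mapGL, hFc]
  have hσa : (F.comp ((mapGL ℚ σ)⁻¹ : GL (Fin 2) ℚ)).a =
      F.a * (σ 1 1 : ℚ) ^ 2 + F.b * (-(σ 1 1 * σ 1 0 : ℚ)) + F.c * (σ 1 0 : ℚ) ^ 2 := by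
    have e1 : σ⁻¹ 0 0 = σ 1 1 := by rw [SL2_inv_expl]; rfl
    have e2 : σ⁻¹ 1 0 = -σ 1 0 := by rw [SL2_inv_expl]; rfl
    simp only [← map_inv, BinForm.comp, BinForm.mapGL_val_apply, e1, e2]
    push_cast
    ring
  have small : ∀ r : ℚ, padicNorm q r * q ≤ padicNorm q F.c →
      padicNorm q r < padicNorm q F.c := fun r hr => by
    obtain h0 | hr0 := (padicNorm.nonneg (p := q) r).eq_or_lt
    · rwa [← h0]
    · exact (lt_mul_of_one_lt_right hr0 hq).trans_le hr
  have hint : ∀ n : ℤ, padicNorm q (n : ℚ) ≤ 1 := padicNorm.of_int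
  have h1 : padicNorm q (F.a * (σ 1 1 : ℚ) ^ 2) < padicNorm q F.c := by
    refine (padicNorm_mul_le le_rfl ?_).trans_lt (small _ hha)
    exact_mod_cast hint (σ 1 1 ^ (2 : ℕ))
  have h2 : padicNorm q (F.b * (-(σ 1 1 * σ 1 0 : ℚ))) < padicNorm q F.c := by
    refine (padicNorm_mul_le le_rfl ?_).trans_lt (small _ hhb)
    rw [padicNorm.neg]
    exact_mod_cast hint (σ 1 1 * σ 1 0)
  have h3 : padicNorm q (F.c * (σ 1 0 : ℚ) ^ 2) < padicNorm q F.c := by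
    have h := padicNorm_add_lt (padicNorm_add_lt (small _ (hga.trans hσc))
      ((padicNorm.neg _).trans_lt h1)) ((padicNorm.neg _).trans_lt h2)
    convert h using 2
    rw [hσa]
    ring
  rw [padicNorm.mul, mul_lt_iff_lt_one_right hcpos, ← Int.cast_pow,
    padicNorm.int_lt_one_iff] at h3
  exact (Nat.prime_iff_prime_int.mp Fact.out).dvd_of_dvd_pow h3

end Height

/-! ### Forms semi-invariant under the stabilizer of a point of the upper half plane -/

/-- A point of the upper half plane as a point of the extended upper half plane. -/
def interiorPoint (z : ℍ) : ExtendedUpperHalfPlane := Sum.inl z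

/-- Each `s` of positive determinant in the stabilizer of `z` multiplies the form `f` by `det s`. -/
def BinForm.IsSemiInvariantAt (f : BinForm) (z : ℍ) : Prop :=
  ∀ s : GL (Fin 2) ℚ, 0 < s.det.val → s • interiorPoint z = interiorPoint z →
    f.comp s = f.scale s.det.val

theorem quadratic_of_smul_eq {s : GL (Fin 2) ℚ} (hs : 0 < s.det.val) {z : ℍ}
    (h : s • interiorPoint z = interiorPoint z) :
    (s 0 0 : ℂ) * z + s 0 1 = z * (s 1 0 * z + s 1 1) := by
  have h1 : GeneralLinearGroup.map (n := Fin 2) (algebraMap ℚ ℝ) s • z = z := Sum.inl.inj h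
  have hdet : 0 < (GeneralLinearGroup.map (n := Fin 2) (algebraMap ℚ ℝ) s).det.val := by
    rw [GeneralLinearGroup.map_det]
    exact Rat.cast_pos.mpr hs
  have h2 := congrArg (UpperHalfPlane.coe) h1
  rw [UpperHalfPlane.coe_smul_of_det_pos hdet,
    div_eq_iff (UpperHalfPlane.denom_ne_zero _ z)] at h2
  simpa [UpperHalfPlane.num, UpperHalfPlane.denom] using h2

theorem rat_linear_eq_zero {z : ℍ} {r t : ℚ} (h : (r : ℂ) * z + t = 0) : r = 0 ∧ t = 0 := by
  have him := congrArg Complex.im h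
  have hr : r = 0 := by simpa [z.im_ne_zero] using him
  subst hr
  exact ⟨rfl, by simpa using h⟩

/-- For each point `z` of the upper half plane there is a nonzero rational form which each `s` in
the stabilizer of `z` multiplies by `det s`. If some `s` in the stabilizer is not scalar, then `z`
is a CM point, and the form is the one that vanishes at `z`; otherwise any form will do. -/
theorem exists_stabilizer_form (z : ℍ) : ∃ f : BinForm, f ≠ ⟨0, 0, 0⟩ ∧
    f.IsSemiInvariantAt z := by
  by_cases hcm : ∃ s : GL (Fin 2) ℚ, 0 < s.det.val ∧
      s • interiorPoint z = interiorPoint z ∧ s 1 0 ≠ 0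
  · obtain ⟨s, hs, hsz, hc⟩ := hcm
    refine ⟨⟨s 1 0, s 1 1 - s 0 0, -s 0 1⟩, fun h => hc (congrArg BinForm.a h),
      fun t ht htz => ?_⟩
    have e1 := quadratic_of_smul_eq hs hsz
    have e2 := quadratic_of_smul_eq ht htz
    -- The rational quadratic equations for `z` given by `s` and by `t` are proportional.
    obtain ⟨h1, h2⟩ := rat_linear_eq_zero (z := z)
      (r := s 1 0 * (t 1 1 - t 0 0) - t 1 0 * (s 1 1 - s 0 0))
      (t := -(s 1 0 * t 0 1) + t 1 0 * s 0 1) (by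
        push_cast
        linear_combination (t 1 0 : ℂ) * e1 - (s 1 0 : ℂ) * e2)
    obtain ⟨k, hk⟩ : ∃ k : ℚ, t 1 0 = k * s 1 0 := ⟨t 1 0 / s 1 0, by field_simp⟩
    have ht11 : t 1 1 = t 0 0 + k * (s 1 1 - s 0 0) := by
      refine mul_left_cancel₀ hc ?_
      rw [hk] at h1
      linear_combination h1
    have ht01 : t 0 1 = k * s 0 1 := by
      refine mul_left_cancel₀ hc ?_
      rw [hk] at h2
      linear_combination -h2
    rw [GeneralLinearGroup.val_det_apply, Matrix.det_fin_two]
    ext <;> simp only [BinForm.comp, BinForm.scale, hk, ht11, ht01] <;> ring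
  · push Not at hcm
    refine ⟨⟨1, 0, 0⟩, by simp, fun s hs hsz => ?_⟩
    have hc := hcm s hs hsz
    have e := quadratic_of_smul_eq hs hsz
    obtain ⟨h1, h2⟩ := rat_linear_eq_zero (z := z) (r := s 0 0 - s 1 1) (t := s 0 1) (by
      rw [hc] at e
      push_cast
      push_cast at e
      linear_combination e)
    rw [GeneralLinearGroup.val_det_apply, Matrix.det_fin_two]
    ext <;> simp only [BinForm.comp, BinForm.scale, hc, h2, sub_eq_zero.mp h1] <;> ring

/-! ### The height on an isogeny class of points of the modular curve -/

theorem ModularCurve.mk_eq_mk {z w : ExtendedUpperHalfPlane} :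
    ModularCurve.mk N H z = ModularCurve.mk N H w ↔
      ∃ σ ∈ GammaH N H, z = mapGL ℚ σ • w := by
  constructor
  · intro h
    obtain ⟨⟨_, σ, hσ, rfl⟩, h⟩ := Quotient.exact (s := MulAction.orbitRel _ _) h
    exact ⟨σ, hσ, h.symm⟩
  · rintro ⟨σ, hσ, rfl⟩
    exact ModularCurve.mk_smul N H ⟨σ, hσ, rfl⟩ w

theorem ModularCurve.mk_mapGL_smul {σ : SL(2, ℤ)} (hσ : σ ∈ GammaH N H)
    (z : ExtendedUpperHalfPlane) : ModularCurve.mk N H (mapGL ℚ σ • z) = ModularCurve.mk N H z :=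
  ModularCurve.mk_smul N H ⟨σ, hσ, rfl⟩ z

theorem det_mapGL (σ : SL(2, ℤ)) : (mapGL ℚ σ : GL (Fin 2) ℚ).det = 1 := by
  ext
  simp

theorem det_mapGL_mul_pos {g : GL (Fin 2) ℚ} (hg : 0 < g.det.val) (σ : SL(2, ℤ)) :
    0 < (mapGL ℚ σ * g).det.val := by
  rwa [map_mul, det_mapGL, one_mul]

theorem det_heckeMatrix_mul_pos {q : ℕ} [NeZero q] {g : GL (Fin 2) ℚ} (hg : 0 < g.det.val) :
    0 < (heckeMatrix q * g).det.val := by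
  rw [map_mul, Units.val_mul, det_heckeMatrix]
  exact mul_pos (Nat.cast_pos.mpr (NeZero.pos q)) hg

open Classical in
/-- The height of a point of the modular curve relative to a point `z` of the upper half plane and a
form `f`: the height of `g` at the image of `g z` with `det g > 0`, and `0` at the points which are
not of this kind. The choice of `g` does not matter if `f` is semi-invariant under the stabilizer
of `z`. -/
noncomputable def pointHeight (q : ℕ) (f : BinForm) (z : ℍ) (x : ModularCurve N H) : ℚ≥0 :=
  if h : ∃ g : GL (Fin 2) ℚ, 0 < g.det.val ∧ x = ModularCurve.mk N H (g • interiorPoint z) then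
    (height q f h.choose).toNNRat
  else 0

theorem exists_of_pointHeight_pos {q : ℕ} {f : BinForm} {z : ℍ} {x : ModularCurve N H}
    (h : 0 < pointHeight q f z x) :
    ∃ g : GL (Fin 2) ℚ, 0 < g.det.val ∧ x = ModularCurve.mk N H (g • interiorPoint z) := by
  by_contra hx
  rw [pointHeight, dif_neg hx] at h
  exact lt_irrefl _ h

theorem heckeT_single_ne_zero_iff [NeZero N] {q : ℕ} [NeZero q] {w : ExtendedUpperHalfPlane}
    {y : ModularCurve N H} :
    heckeT N H q (Finsupp.single (ModularCurve.mk N H w) 1) y ≠ 0 ↔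
      ∃ γ ∈ GammaH N H, y = ModularCurve.mk N H ((heckeMatrix q * mapGL ℚ γ) • w) := by
  classical
  rw [heckeT, doubleCosetEnd_single, Finsupp.finsetSum_apply]
  simp only [Finsupp.single_apply]
  rw [Finset.sum_boole, Nat.cast_ne_zero, Finset.card_ne_zero]
  constructor
  · rintro ⟨c, hc⟩
    obtain ⟨hc', rfl⟩ := Finset.mem_filter.mp hc
    rw [Set.Finite.mem_toFinset, mem_cosetsIn] at hc'
    obtain ⟨γ, hγ, rfl⟩ := hc'
    exact ⟨γ, hγ, rfl⟩
  · rintro ⟨γ, hγ, rfl⟩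
    refine ⟨RightCoset.mk N H (heckeMatrix q * mapGL ℚ γ), Finset.mem_filter.mpr ⟨?_, rfl⟩⟩
    rw [Set.Finite.mem_toFinset, mem_cosetsIn]
    exact ⟨γ, hγ, rfl⟩

/-- Conjugation by `diag(1, q)` preserves `Γ_H` on matrices whose lower left entry is divisible
by `q`. -/
theorem exists_gammaH_conj {q : ℕ} [Fact q.Prime] (hqN : ¬ q ∣ N) {σ : SL(2, ℤ)}
    (hσ : σ ∈ GammaH N H) (hq : (q : ℤ) ∣ σ 1 0) :
    ∃ τ ∈ GammaH N H, mapGL ℚ σ * heckeMatrix q = heckeMatrix q * mapGL ℚ τ := by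
  obtain ⟨σ₀, hσ₀, rfl⟩ := hσ
  obtain ⟨k, hk⟩ := hq
  change (σ₀ : SL(2, ℤ)) 1 0 = q * k at hk
  have hdet := (σ₀ : SL(2, ℤ)).det_coe
  rw [Matrix.det_fin_two] at hdet
  obtain ⟨τ, hτ⟩ : ∃ τ : SL(2, ℤ), (τ : Matrix (Fin 2) (Fin 2) ℤ) =
      !![(σ₀ : SL(2, ℤ)) 0 0, (σ₀ : SL(2, ℤ)) 0 1 * q; k, (σ₀ : SL(2, ℤ)) 1 1] := by
    refine ⟨⟨_, ?_⟩, rfl⟩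
    rw [Matrix.det_fin_two_of]
    rw [hk] at hdet
    linear_combination hdet
  have hτ0 : τ ∈ Gamma0 N := by
    rw [Gamma0_mem, hτ]
    change ((k : ℤ) : ZMod N) = 0
    have hN : (((σ₀ : SL(2, ℤ)) 1 0 : ℤ) : ZMod N) = 0 := Gamma0_mem.mp σ₀.2
    rw [ZMod.intCast_zmod_eq_zero_iff_dvd] at hN ⊢
    rw [hk] at hN
    exact (Nat.isCoprime_iff_coprime.mpr
      ((Fact.out : q.Prime).coprime_iff_not_dvd.mpr hqN).symm).dvd_of_dvd_mul_left hN
  refine ⟨τ, ⟨⟨τ, hτ0⟩, ?_, rfl⟩, ?_⟩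
  · have hmap : (Gamma0Map N).toHomUnits ⟨τ, hτ0⟩ = (Gamma0Map N).toHomUnits σ₀ := by
      refine Units.ext ?_
      change ((τ 1 1 : ℤ) : ZMod N) = (((σ₀ : SL(2, ℤ)) 1 1 : ℤ) : ZMod N)
      rw [hτ]
      rfl
    change diamondClass N H _ = 1
    change diamondClass N H _ = 1 at hσ₀
    rw [← hσ₀]
    simp only [diamondClass, MonoidHom.comp_apply, hmap]
  · ext i j
    rw [Units.val_mul, Units.val_mul, val_heckeMatrix]
    fin_cases i <;> fin_cases j <;>
      simp [Matrix.mul_apply, Fin.sum_univ_two, hτ, hk, mul_comm]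

section PointHeight

variable {q : ℕ} [Fact q.Prime] {f : BinForm} {z : ℍ}

theorem pointHeight_mk
    (hstab : f.IsSemiInvariantAt z) {g : GL (Fin 2) ℚ} (hg : 0 < g.det.val) :
    (pointHeight q f z (ModularCurve.mk N H (g • interiorPoint z)) : ℚ) = height q f g := by
  have h : ∃ k : GL (Fin 2) ℚ, 0 < k.det.val ∧
      ModularCurve.mk N H (g • interiorPoint z) = ModularCurve.mk N H (k • interiorPoint z) := ⟨g, hg, rfl⟩
  rw [pointHeight, dif_pos h]
  rw [Rat.coe_toNNRat _ (height_nonneg q f _)]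
  obtain ⟨hk, he⟩ := h.choose_spec
  generalize h.choose = k at hk he
  obtain ⟨σ, -, he⟩ := ModularCurve.mk_eq_mk.mp he
  have hfix : (g⁻¹ * (mapGL ℚ σ * k))⁻¹ • interiorPoint z =
      interiorPoint z := by
    rw [inv_smul_eq_iff, mul_smul, mul_smul, ← he, inv_smul_smul]
  have hdet : 0 < ((g⁻¹ * (mapGL ℚ σ * k))⁻¹).det.val := by
    simp only [map_mul, map_inv, det_mapGL, one_mul, Units.val_mul, Units.val_inv_eq_inv_val]
    exact inv_pos.mpr (mul_pos (inv_pos.mpr hg) hk)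
  have h1 := height_mul_of_comp_eq (q := q) (hstab _ hdet hfix) g
  rwa [mul_inv_cancel_left, height_mapGL_mul] at h1

theorem pointHeight_diamond_le [NeZero N] (hstab : f.IsSemiInvariantAt z)
    (a : DiamondGroup N ⧸ H) (x : ModularCurve N H) :
    pointHeight q f z (diamond N H a x) ≤ pointHeight q f z x := by
  obtain h0 | hpos := (zero_le (a := pointHeight q f z (diamond N H a x))).eq_or_lt
  · rw [← h0]
    exact zero_le
  obtain ⟨g, hg, he⟩ := exists_of_pointHeight_pos hpos
  obtain ⟨γ, hγ⟩ := diamondClass_surjective N H a⁻¹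
  have hx : x = ModularCurve.mk N H ((mapGL ℚ (γ : SL(2, ℤ)) * g) • interiorPoint z) := by
    rw [mul_smul, ← diamond_mk, ← he, hγ, ← Equiv.Perm.mul_apply, ← map_mul, inv_mul_cancel,
      map_one, Equiv.Perm.one_apply]
  rw [he, ← NNRat.coe_le_coe, hx, pointHeight_mk hstab hg,
    pointHeight_mk hstab (det_mapGL_mul_pos hg _), height_mapGL_mul]

theorem pointHeight_heckeT_le [NeZero N] (hstab : f.IsSemiInvariantAt z)
    (x y : ModularCurve N H)
    (h : heckeT N H q (Finsupp.single x 1) y ≠ 0) :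
    pointHeight q f z y ≤ q * pointHeight q f z x := by
  obtain h0 | hpos := (zero_le (a := pointHeight q f z y)).eq_or_lt
  · rw [← h0]
    exact zero_le
  obtain ⟨k, hk, rfl⟩ := exists_of_pointHeight_pos hpos
  induction x using Quotient.inductionOn with
  | h w =>
  obtain ⟨γ, hγ, he⟩ := heckeT_single_ne_zero_iff.mp h
  obtain ⟨σ, -, he⟩ := ModularCurve.mk_eq_mk.mp he.symm
  set g := (heckeMatrix q)⁻¹ * (mapGL ℚ σ * k) with hgdef
  have hw : ModularCurve.mk N H w = ModularCurve.mk N H (g • interiorPoint z) := by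
    rw [hgdef, mul_smul, mul_smul, ← he, mul_smul, inv_smul_smul, ModularCurve.mk_mapGL_smul hγ]
  have hg : 0 < g.det.val := by
    rw [map_mul, map_inv, Units.val_mul, Units.val_inv_eq_inv_val, det_heckeMatrix]
    exact mul_pos (inv_pos.mpr (Nat.cast_pos.mpr (NeZero.pos q))) (det_mapGL_mul_pos hk σ)
  change _ ≤ q * pointHeight q f z (ModularCurve.mk N H w)
  rw [hw, ← NNRat.coe_le_coe, NNRat.coe_mul, pointHeight_mk hstab hk, pointHeight_mk hstab hg,
    NNRat.coe_natCast, ← height_mapGL_mul f σ k]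
  have hkg : mapGL ℚ σ * k = heckeMatrix q * g := by rw [hgdef, mul_inv_cancel_left]
  rw [hkg]
  exact height_heckeMatrix_mul_le f g

theorem exists_pointHeight_heckeT_eq [NeZero N] (hstab : f.IsSemiInvariantAt z)
    (hqN : ¬ q ∣ N) (hf : f ≠ ⟨0, 0, 0⟩)
    (x : ModularCurve N H) (hx : 0 < pointHeight q f z x) :
    ∃ y, heckeT N H q (Finsupp.single x 1) y ≠ 0 ∧
      pointHeight q f z y = q * pointHeight q f z x := by
  obtain ⟨g, hg, rfl⟩ := exists_of_pointHeight_pos hx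
  obtain ⟨γ, hγ, h⟩ := exists_gamma_height_eq hqN hf g
  refine ⟨ModularCurve.mk N H ((heckeMatrix q * mapGL ℚ γ * g) • interiorPoint z),
    heckeT_single_ne_zero_iff.mpr ⟨γ, Gamma_le_GammaH N H hγ, by rw [mul_smul]⟩, ?_⟩
  have hpos : 0 < (heckeMatrix q * mapGL ℚ γ * g).det.val := by
    rw [mul_assoc]
    exact det_heckeMatrix_mul_pos (det_mapGL_mul_pos hg γ)
  rw [← NNRat.coe_inj, NNRat.coe_mul, pointHeight_mk hstab hpos, pointHeight_mk hstab hg, h,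
    NNRat.coe_natCast]

theorem eq_of_pointHeight_heckeT_eq [NeZero N] (hstab : f.IsSemiInvariantAt z)
    (hqN : ¬ q ∣ N) (hf : f ≠ ⟨0, 0, 0⟩)
    (x x' y : ModularCurve N H) (hx : 0 < pointHeight q f z x)
    (hx' : pointHeight q f z x' = pointHeight q f z x)
    (hy : pointHeight q f z y = q * pointHeight q f z x)
    (hxy : heckeT N H q (Finsupp.single x 1) y ≠ 0)
    (hxy' : heckeT N H q (Finsupp.single x' 1) y ≠ 0) : x' = x := by
  -- Absorb the element of `Γ_H` in `diag(1, q) γ` into the matrix that represents the point.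
  have key : ∀ w : ModularCurve N H, 0 < pointHeight q f z w →
      heckeT N H q (Finsupp.single w 1) y ≠ 0 →
      ∃ g : GL (Fin 2) ℚ, 0 < g.det.val ∧ w = ModularCurve.mk N H (g • interiorPoint z) ∧
        y = ModularCurve.mk N H ((heckeMatrix q * g) • interiorPoint z) := by
    intro w hw h
    obtain ⟨g, hg, rfl⟩ := exists_of_pointHeight_pos hw
    obtain ⟨γ, hγ, rfl⟩ := heckeT_single_ne_zero_iff.mp h
    refine ⟨mapGL ℚ γ * g, det_mapGL_mul_pos hg γ, ?_, ?_⟩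
    · rw [mul_smul, ModularCurve.mk_mapGL_smul hγ]
    · rw [← mul_smul, mul_assoc]
  obtain ⟨g, hg, rfl, rfl⟩ := key x hx hxy
  obtain ⟨k, hk, rfl, he⟩ := key x' (hx' ▸ hx) hxy'
  obtain ⟨σ, hσ, hz⟩ := ModularCurve.mk_eq_mk.mp he
  set h := (heckeMatrix q)⁻¹ * (mapGL ℚ σ * (heckeMatrix q * k)) with hdef
  have hh : heckeMatrix q * h = mapGL ℚ σ * (heckeMatrix q * k) := by
    rw [hdef, mul_inv_cancel_left]
  have hhz : h • interiorPoint z = g • interiorPoint z := by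
    rw [hdef, mul_smul, mul_smul, ← hz, mul_smul, inv_smul_smul]
  have hhpos : 0 < h.det.val := by
    rw [map_mul, map_inv, Units.val_mul, Units.val_inv_eq_inv_val, det_heckeMatrix]
    exact mul_pos (inv_pos.mpr (Nat.cast_pos.mpr (NeZero.pos q)))
      (det_mapGL_mul_pos (det_heckeMatrix_mul_pos hk) σ)
  have hyh := congrArg (NNRat.cast : ℚ≥0 → ℚ) hy
  rw [mul_smul, ← hhz, ← mul_smul, NNRat.cast_mul, pointHeight_mk hstab hhpos,
    pointHeight_mk hstab (det_heckeMatrix_mul_pos hhpos), NNRat.cast_natCast] at hyh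
  have hyk := congrArg (NNRat.cast : ℚ≥0 → ℚ) hy
  rw [he, ← hx', NNRat.cast_mul, pointHeight_mk hstab hk,
    pointHeight_mk hstab (det_heckeMatrix_mul_pos hk), NNRat.cast_natCast] at hyk
  obtain ⟨τ, hτ, hconj⟩ := exists_gammaH_conj hqN hσ (dvd_of_height_eq hf hh hyh hyk)
  have hhk : h = mapGL ℚ τ * k := by
    rw [hdef, ← mul_assoc (mapGL ℚ σ), hconj, mul_assoc, inv_mul_cancel_left]
  rw [← hhz, hhk, mul_smul, ModularCurve.mk_mapGL_smul hτ]

end PointHeight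

end ModularHecke

theorem mainTheorem8 (N : ℕ) [NeZero N] (H : Subgroup (ModularHecke.DiamondGroup N))
    (h₁ h₂ : (MonoidAlgebra ℕ (ModularHecke.DiamondGroup N ⧸ H))[X])
    (hmonic : h₁.Monic) (hdeg : h₂.degree < h₁.degree)
    (q : ℕ) [Fact q.Prime] (hqN : ¬ q ∣ N) :
    ModularHecke.IsEffectiveCorrespondence (ModularHecke.heckePoly N H q h₁) ∧
    ModularHecke.IsEffectiveCorrespondence (ModularHecke.heckePoly N H q h₂) ∧
    ∀ D : ModularHecke.Divisor N H,
      (ModularHecke.heckePoly N H q h₁ - ModularHecke.heckePoly N H q h₂) D = 0 →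
      ∀ x ∈ D.support, x.IsCusp := by
  refine ⟨ModularHecke.heckePoly_isEffectiveCorrespondence q h₁,
    ModularHecke.heckePoly_isEffectiveCorrespondence q h₂, fun D hD x hx => ?_⟩
  obtain ⟨w, rfl⟩ : ∃ w, ModularHecke.ModularCurve.mk N H w = x := Quotient.exists_rep x
  obtain z | c := w
  swap
  · exact ⟨c, rfl⟩
  obtain ⟨f, hf, hstab⟩ := ModularHecke.exists_stabilizer_form z
  have hq := (Fact.out : q.Prime).one_lt
  have hT : ∀ E : ModularHecke.Divisor N H,
      ModularHecke.topHeight (ModularHecke.pointHeight q f z) (ModularHecke.heckeT N H q E) =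
        q * ModularHecke.topHeight (ModularHecke.pointHeight q f z) E :=
    ModularHecke.topHeight_end_eq (ModularHecke.pointHeight_heckeT_le hstab)
      (ModularHecke.exists_pointHeight_heckeT_eq hstab hqN hf)
      (ModularHecke.eq_of_pointHeight_heckeT_eq hstab hqN hf)
      (Nat.cast_pos.mpr (zero_lt_one.trans hq))
  have htop := ModularHecke.topHeight_eq_zero_of_heckePoly_eq hq
    (ModularHecke.pointHeight_diamond_le hstab) hT hmonic hdeg (sub_eq_zero.mp hD)
  have hle := ModularHecke.le_topHeight (ht := ModularHecke.pointHeight q f z)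
    (Finsupp.mem_support_iff.mp hx)
  have hpos : (0 : ℚ) < ModularHecke.pointHeight q f z
      (ModularHecke.ModularCurve.mk N H ((1 : GL (Fin 2) ℚ) • ModularHecke.interiorPoint z)) := by
    rw [ModularHecke.pointHeight_mk hstab (by simp)]
    exact ModularHecke.height_pos hf 1
  rw [one_smul] at hpos
  exact absurd (NNRat.coe_pos.mp hpos) (not_lt.mpr (hle.trans_eq htop))
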